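/- Let $n\ge 2$. The root poset $\Phi^+(A_{n-1})$ is the set of intervals $[i,j]$ with $1\le i<j\le n$, ordered by containment; it is ranked by $\operatorname{rk}([i,j])=j-i-1$ and has rank $r=n-2$. For a finite ranked poset $P$ of rank $r$ let $\mathcal A(P)$ be its set of antichains. For $A\in\mathcal A(P)$, rowmotion is $\operatorname{row}(A)=\min\{x\in P: x\not\le y\text{ for all }y\in A\}$. For $p\in P$, the toggle $\tau_p$ sends $A\in\mathcal A(P)$ to $A\setminus\{p\}$ if $p\in A$, to $A\cup\{p\}$ if $p\notin A$ and $A\cup\{p\}$ is an antichain, and to $A$ otherwise. Let $\boldsymbol\tau_i$ be the product of the (commuting) toggles $\tau_p$ over the elements $p$ of rank $i$. Rowvacuation is the composition (the rightmost map is applied first) \[\operatorname{Rvac}=(\boldsymbol\tau_r)(\boldsymbol\tau_r\boldsymbol\tau_{r-1})\cdots(\boldsymbol\tau_r\cdots\boldsymbol\tau_1)(\boldsymbol\tau_r\cdots\boldsymbol\tau_1\boldsymbol\tau_0).\] For $A\in\mathcal A(\Phi^+(A_{n-1}))$ the diagram $\varphi_{A_{n-1}}(A)$ is built as follows. Place $2n$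 vertices labeled $1^{(0)},2^{(0)},\dots,n^{(0)},n^{(1)},\dots,2^{(1)},1^{(1)}$ in clockwise order at evenly spaced positions on a circle in the plane. For each $[i,j]\in A$ put the marking $i$ on $j^{(0)}$; for each $i\in\{1,\dots,n\}$ that is not the left endpoint of an interval in $A$ put the marking $i$ on $i^{(1)}$. For $i=1,\dots,n$ in this order, draw a straight edge from the vertex with marking $i$ to the closest unmarked vertex that is not yet on an edge, where closest is determined by moving counterclockwise if the vertex with marking $i$ has superscript $(0)$, and clockwise if it has superscript $(1)$. Finally discard the markings and relabel the vertices $1^{(0)},2^{(0)},\dots,n^{(0)},n^{(1)},\dots,2^{(1)},1^{(1)}$ as $p_1^{(0)},p_1^{(1)},p_2^{(0)},p_2^{(1)},\dots,p_n^{(0)},p_n^{(1)}$, respectively, where $p_1,\dots,p_n$ lists the even elements of $\{1,\dots,n\}$ in increasing order followed by the odd elements in decreasing order. All diagrams are drawn with the same vertex positions. Let $M$ be the line through the center of the circle that is equidistant from the vertices $2^{(0)}$ and $2^{(1)}$ of the relabeled diagram. Then for every $A\in\mathcal A(\Phi^+(A_{n-1}))$ the diagram $\varphi_{A_{n-1}}(\operatorname{row}(\operatorname{Rvac}(A)))$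 is obtained from $\varphi_{A_{n-1}}(A)$ by reflecting all of the edges through the line $M$ and leaving the (labeled) vertices unchanged. -/

import Mathlib

namespace RowvacA

/-! ### Rowmotion and rowvacuation on a finite ranked poset

`GradeMinOrder ℕ P` says that `P` is ranked with rank function `grade ℕ`: minimal elements have
rank `0`, and `x ⋖ y` implies that the rank of `y` is one more than that of `x`. -/

section Poset

/-- The set of antichains of `P`. -/
abbrev Antichains (P : Type*) [PartialOrder P] : Type _ :=
  {A : Finset P // IsAntichain (· ≤ ·) (A : Set P)}

open Classical in
/-- Rowmotion: `row A` is the set of minimal elements of `{x | x ≰ y for all y ∈ A}`. -/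
noncomputable def row {P : Type*} [PartialOrder P] [Fintype P] (A : Antichains P) :
    Antichains P :=
  ⟨Finset.univ.filter fun x => Minimal (fun z => ∀ y ∈ A.1, ¬ z ≤ y) x, by
    intro x hx y hy hxy hle
    have hx' := (Finset.mem_filter.mp (Finset.mem_coe.mp hx)).2
    have hy' := (Finset.mem_filter.mp (Finset.mem_coe.mp hy)).2
    exact hxy (le_antisymm hle (hy'.2 hx'.1 hle))⟩

open Classical in
/-- The antichain toggle at `p`. -/
noncomputable def toggle {P : Type*} [PartialOrder P] (p : P) : Function.End (Antichains P) :=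
  fun A =>
    if p ∈ A.1 then
      ⟨A.1.erase p, A.2.subset (Finset.coe_subset.mpr (Finset.erase_subset p A.1))⟩
    else if h : IsAntichain (· ≤ ·) ((insert p A.1 : Finset P) : Set P) then ⟨insert p A.1, h⟩
    else A

theorem mem_toggle {P : Type*} [PartialOrder P] (p x : P) (A : Antichains P) :
    x ∈ (toggle p A).1 ↔
      (x ≠ p ∧ x ∈ A.1) ∨ (x = p ∧ p ∉ A.1 ∧ ∀ b ∈ A.1, ¬ p ≤ b ∧ ¬ b ≤ p) := by
  classical
  have key : p ∉ A.1 → (IsAntichain (· ≤ ·) ((insert p A.1 : Finset P) : Set P) ↔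
      ∀ b ∈ A.1, ¬ p ≤ b ∧ ¬ b ≤ p) := by
    intro hp
    rw [Finset.coe_insert, isAntichain_insert]
    constructor
    · rintro ⟨-, h⟩ b hb
      have := h (Finset.mem_coe.mpr hb) (fun e => hp (e ▸ hb))
      exact ⟨this.1, this.2⟩
    · exact fun h => ⟨A.2, fun b hb _ => h b hb⟩
  unfold toggle
  by_cases hp : p ∈ A.1
  · simp [hp]
  · by_cases h : IsAntichain (· ≤ ·) ((insert p A.1 : Finset P) : Set P)
    · have h' := (key hp).mp h
      rw [if_neg hp, dif_pos h]
      by_cases hx : x = p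
      · subst hx; simpa [hp] using h'
      · simp [hx]
    · have h' := fun hh => h ((key hp).mpr hh)
      rw [if_neg hp, dif_neg h]
      by_cases hx : x = p
      · subst hx; simpa [hp] using h'
      · simp [hx]

theorem toggle_commute {P : Type*} [PartialOrder P] {p q : P} (hpq : ¬ p ≤ q) (hqp : ¬ q ≤ p) :
    Commute (toggle p) (toggle q) := by
  have hne : p ≠ q := fun h => hpq h.le
  funext A
  apply Subtype.ext
  ext x
  change x ∈ (toggle p (toggle q A)).1 ↔ x ∈ (toggle q (toggle p A)).1
  simp only [mem_toggle]
  grind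

/-- The rank toggle: the product of the (pairwise commuting) toggles at the elements of
rank `i`. -/
noncomputable def rankToggle (P : Type*) [PartialOrder P] [Fintype P] [GradeMinOrder ℕ P]
    (i : ℕ) : Function.End (Antichains P) :=
  (Finset.univ.filter fun p : P => grade ℕ p = i).noncommProd toggle (by
    intro p hp q hq hpq
    have hp' : grade ℕ p = i := (Finset.mem_filter.mp (Finset.mem_coe.mp hp)).2
    have hq' : grade ℕ q = i := (Finset.mem_filter.mp (Finset.mem_coe.mp hq)).2
    refine toggle_commute (fun h => ?_) (fun h => ?_)
    · have := grade_strictMono (𝕆 := ℕ) (lt_of_le_of_ne h hpq)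
      omega
    · have := grade_strictMono (𝕆 := ℕ) (lt_of_le_of_ne h hpq.symm)
      omega)

/-- The rank of the poset: the largest value of its rank function. -/
def posetRank (P : Type*) [PartialOrder P] [Fintype P] [GradeMinOrder ℕ P] : ℕ :=
  Finset.univ.sup fun p : P => grade ℕ p

/-- The product `τ_r τ_{r-1} ⋯ τ_k` of rank toggles, where `r` is the rank of the poset
(`τ_k` acts first). -/
noncomputable def rankTogglesFrom (P : Type*) [PartialOrder P] [Fintype P] [GradeMinOrder ℕ P]
    (k : ℕ) : Function.End (Antichains P) :=
  ((List.range' k (posetRank P + 1 - k)).reverse.map (rankToggle P)).prod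

/-- Rowvacuation `(τ_r)(τ_r τ_{r-1}) ⋯ (τ_r ⋯ τ_1)(τ_r ⋯ τ_1 τ_0)`, where `r` is the rank of
the poset (the rightmost factor acts first). -/
noncomputable def Rvac {P : Type*} [PartialOrder P] [Fintype P] [GradeMinOrder ℕ P] :
    Function.End (Antichains P) :=
  ((List.range (posetRank P + 1)).reverse.map (rankTogglesFrom P)).prod

end Poset

/-! ### The root poset of type `A_{n-1}` -/

/-- The root poset `Φ⁺(A_{n-1})`, realized as the set of intervals `[lo, hi]` with
`1 ≤ lo < hi ≤ n`; the interval `[i, j]` stands for the root `e_i - e_j`. -/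
@[ext]
structure RootA (n : ℕ) where
  lo : ℕ
  hi : ℕ
  one_le : 1 ≤ lo
  lt : lo < hi
  le_n : hi ≤ n

/-- Intervals are ordered by containment. -/
instance (n : ℕ) : PartialOrder (RootA n) where
  le a b := b.lo ≤ a.lo ∧ a.hi ≤ b.hi
  le_refl a := ⟨le_rfl, le_rfl⟩
  le_trans a b c h h' := ⟨h'.1.trans h.1, h.2.trans h'.2⟩
  le_antisymm a b h h' := RootA.ext (le_antisymm h'.1 h.1) (le_antisymm h.2 h'.2)

noncomputable instance (n : ℕ) : Fintype (RootA n) :=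
  Fintype.ofInjective
    (fun a : RootA n =>
      ((⟨a.lo, by have := a.lt; have := a.le_n; omega⟩, ⟨a.hi, by have := a.le_n; omega⟩) :
        Fin (n + 1) × Fin (n + 1)))
    (fun a b h => by
      simp only [Prod.mk.injEq, Fin.mk.injEq] at h
      exact RootA.ext h.1 h.2)

/-- The rank of `[i, j]` is `j - i - 1`, the height of `e_i - e_j` minus one. -/
instance (n : ℕ) : GradeMinOrder ℕ (RootA n) where
  grade a := a.hi - a.lo - 1
  grade_strictMono := by
    intro a b hab
    obtain ⟨⟨h1, h2⟩, h3⟩ := lt_iff_le_not_ge.mp hab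
    have h4 : ¬ (a.lo ≤ b.lo ∧ b.hi ≤ a.hi) := h3
    have := a.lt
    have := b.lt
    show a.hi - a.lo - 1 < b.hi - b.lo - 1
    omega
  covBy_grade := by
    intro a b hab
    obtain ⟨⟨h1, h2⟩, h3⟩ := lt_iff_le_not_ge.mp hab.lt
    have h4 : ¬ (a.lo ≤ b.lo ∧ b.hi ≤ a.hi) := h3
    have ha := a.lt
    have hb := b.lt
    have ha1 := a.one_le
    have hbn := b.le_n
    have hb1 := b.one_le
    rw [Nat.covBy_iff_add_one_eq]
    by_contra hne
    by_cases h5 : b.lo < a.lo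
    · let c : RootA n := ⟨a.lo - 1, a.hi, by omega, by omega, a.le_n⟩
      refine hab.2 (c := c) (lt_iff_le_not_ge.mpr ⟨⟨?_, ?_⟩, fun h => ?_⟩)
        (lt_iff_le_not_ge.mpr ⟨⟨?_, ?_⟩, fun h => ?_⟩)
      · show a.lo - 1 ≤ a.lo
        omega
      · show a.hi ≤ a.hi
        omega
      · have h6 : a.lo ≤ a.lo - 1 := h.1
        omega
      · show b.lo ≤ a.lo - 1
        omega
      · show a.hi ≤ b.hi
        omega
      · have h6 : a.lo - 1 ≤ b.lo := h.1
        have h7 : b.hi ≤ a.hi := h.2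
        omega
    · let c : RootA n := ⟨a.lo, a.hi + 1, by omega, by omega, by omega⟩
      refine hab.2 (c := c) (lt_iff_le_not_ge.mpr ⟨⟨?_, ?_⟩, fun h => ?_⟩)
        (lt_iff_le_not_ge.mpr ⟨⟨?_, ?_⟩, fun h => ?_⟩)
      · show a.lo ≤ a.lo
        omega
      · show a.hi ≤ a.hi + 1
        omega
      · have h6 : a.hi + 1 ≤ a.hi := h.2
        omega
      · show b.lo ≤ a.lo
        omega
      · show a.hi + 1 ≤ b.hi
        omega
      · have h6 : a.lo ≤ b.lo := h.1
        have h7 : b.hi ≤ a.hi + 1 := h.2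
        omega
  isMin_grade := by
    intro a ha
    have h1 := a.lt
    have h2 := a.le_n
    let c : RootA n := ⟨a.lo, a.lo + 1, a.one_le, by omega, by omega⟩
    have h3 : a ≤ c := ha (show c ≤ a from ⟨le_rfl, by show a.lo + 1 ≤ a.hi; omega⟩)
    have h4 : a.hi ≤ a.lo + 1 := h3.2
    rw [isMin_iff_eq_bot]
    show a.hi - a.lo - 1 = 0
    omega

/-! ### Diagrams

The `2n` evenly spaced places on the circle are numbered clockwise by `ZMod (2 * n)`, so adding
`1` is one step clockwise and subtracting `1` is one step counterclockwise. -/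

/-- The circle on which diagrams are drawn, with the angle (argument relative to the center) of
place number `0`. -/
structure Frame where
  center : ℂ
  radius : ℝ
  angle : ℝ
  radius_pos : 0 < radius

/-- The point of the plane at place `k`, that is, `k` steps clockwise from place `0`. -/
noncomputable def Frame.point (F : Frame) {n : ℕ} (k : ZMod (2 * n)) : ℂ :=
  F.center + F.radius *
    Complex.exp (((F.angle - 2 * Real.pi * (k.val : ℝ) / (2 * n : ℝ) : ℝ) : ℂ) * Complex.I)

/-- The place of `i^(s)` when the labels `1^(0), 2^(0), …, n^(0), n^(1), …, 2^(1), 1^(1)` are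
placed clockwise, starting at place `0`. -/
def psiPlace (n i : ℕ) (s : Fin 2) : ZMod (2 * n) :=
  if s = 0 then (i : ZMod (2 * n)) - 1 else -(i : ZMod (2 * n))

/-- The sequence `p_1, …, p_n`: the even elements of `[n]` in increasing order, followed by the
odd elements of `[n]` in decreasing order. -/
def pSeq (n : ℕ) : List ℕ :=
  (List.range' 1 n).filter (fun i => Even i) ++ ((List.range' 1 n).filter (fun i => Odd i)).reverse

/-- The place of `v^(s)` when the labels `p_1^(0), p_1^(1), p_2^(0), p_2^(1), …, p_n^(0), p_n^(1)`
are placed clockwise, starting at place `0`. -/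
def phiPlace (n v : ℕ) (s : Fin 2) : ZMod (2 * n) :=
  ((2 * (pSeq n).idxOf v + s.val : ℕ) : ZMod (2 * n))

open Classical in
/-- The place carrying the marking `i`, with the direction (`-1` counterclockwise, `+1` clockwise)
in which the edge from it is sought: `j^(0)` and counterclockwise if `[i, j] ∈ A` (there is at most
one such `j`), and `i^(1)` and clockwise if `A` has no interval with left end `i`. -/
noncomputable def marker {n : ℕ} (A : Antichains (RootA n)) (i : ℕ) :
    ZMod (2 * n) × ZMod (2 * n) :=
  if h : ∃ a ∈ A.1, a.lo = i then (psiPlace n h.choose.hi 0, -1) else (psiPlace n i 1, 1)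

/-- A place is available, given the edges `E` already drawn, if it carries no marking and is not
on an edge. -/
def Available {n : ℕ} (A : Antichains (RootA n)) (E : Set (Sym2 (ZMod (2 * n))))
    (v : ZMod (2 * n)) : Prop :=
  (∀ i ∈ Finset.Icc 1 n, (marker A i).1 ≠ v) ∧ ∀ e ∈ E, v ∉ e

/-- The place that the marking `i` is connected to, given the edges `E` already drawn: the first
available place met when moving from the marking in its direction. -/
noncomputable def partner {n : ℕ} (A : Antichains (RootA n)) (E : Set (Sym2 (ZMod (2 * n))))
    (i : ℕ) : ZMod (2 * n) :=
  (marker A i).1 +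
    (sInf {d : ℕ | Available A E ((marker A i).1 + d * (marker A i).2)} : ℕ) * (marker A i).2

/-- The edges (as pairs of places) after the first `k` edges have been added. -/
noncomputable def edgesUpTo {n : ℕ} (A : Antichains (RootA n)) :
    ℕ → Set (Sym2 (ZMod (2 * n)))
  | 0 => ∅
  | k + 1 => insert s((marker A (k + 1)).1, partner A (edgesUpTo A k) (k + 1)) (edgesUpTo A k)

/-- A diagram in the plane: the vertices are points labeled `i^(s)` with `i ∈ [n]` and `s ∈ {0,1}`,
and the edges are straight line segments. -/
@[ext]
structure Diagram (n : ℕ) where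
  vertex : Set.Icc 1 n → Fin 2 → ℂ
  edges : Set (Set ℂ)

/-- The diagram `ψ_{A_{n-1}}(A)`. -/
noncomputable def psi (F : Frame) {n : ℕ} (A : Antichains (RootA n)) : Diagram n where
  vertex i s := F.point (psiPlace n i s)
  edges := {e | ∃ u v : ZMod (2 * n), s(u, v) ∈ edgesUpTo A n ∧
    e = segment ℝ (F.point u) (F.point v)}

/-- The diagram `φ_{A_{n-1}}(A)`, obtained from `ψ_{A_{n-1}}(A)` by relabeling the vertices. -/
noncomputable def phi (F : Frame) {n : ℕ} (A : Antichains (RootA n)) : Diagram n where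
  vertex v s := F.point (phiPlace n v s)
  edges := (psi F A).edges

/-- The line `M` of the points equidistant from the vertices `2^(0)` and `2^(1)`. -/
noncomputable def lineM {n : ℕ} (hn : 2 ≤ n) (D : Diagram n) : AffineSubspace ℝ ℂ :=
  AffineSubspace.perpBisector (D.vertex ⟨2, by norm_num, hn⟩ 0) (D.vertex ⟨2, by norm_num, hn⟩ 1)

instance {n : ℕ} (hn : 2 ≤ n) (D : Diagram n) : Nonempty (lineM hn D) :=
  AffineSubspace.perpBisector_nonempty.to_subtype

/-- Reflect all edges of a diagram through `M`, leaving the vertices unchanged. -/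
noncomputable def Diagram.reflectEdges {n : ℕ} (hn : 2 ≤ n) (D : Diagram n) : Diagram n where
  vertex := D.vertex
  edges := (fun e => EuclideanGeometry.reflection (lineM hn D) '' e) '' D.edges

end RowvacA

namespace RowvacA

/-! ### Rank toggles applied from the bottom up, in a general ranked poset. -/

section Poset

variable {P : Type*} [PartialOrder P]

/-! Represent the places modulo `2 * n` by the positions `-n, …, n - 1`, with j^(0) at `j - 1` and
i^(1) at `-i`. The marked positions are then `j - 1` for the right ends `j` of `A`, and `-i` for the
`i` that are not left ends. The diagram is a noncrossing perfect matching in which the marked end of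
each edge is the one met later in the sweep `0, -1, 1, -2, 2, …`. Conversely, any matching with this
property for the marks of `A` has the edges of the diagram (`IsMatching.mem_edgesUpTo`). It
therefore suffices to turn a matching for `A` into one for `row (Rvac A)`.

Rowvacuation: an induction on the lowest rank toggled (`RvacFrom_spec`) shows that, within range,
`x` is a left end of `Rvac A` iff `x + 1` is not a right end of `A`, and `x + 1` is a right end of
`Rvac A` iff `x` is not a left end of `A`. So the marks are reflected by `p ↦ -p`. Edges join
positions of opposite parity, and for such pairs this reflection preserves the sweep order
(`IsMatching.reflect_Rvac`).

Rowmotion: left ends move down by one and right ends move up by one, apart from new intervals `[x, x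
+ 1]` where no interval of `A` contains `[x, x + 1]`. The resulting exceptional marks occur exactly
at edges joining `x` and `-x - 1`, and these are exactly the edges whose sweep order is reversed by
`p ↦ p + 1`. So the matching is rotated by one step (`IsMatching.rotate_row`).

The composite is `p ↦ 1 - p` modulo `2 * n`. It exchanges places 0 and 1, which after relabeling
carry 2^(0) and 2^(1), so it is the reflection through `M`. -/

theorem mem_noncommProd_toggle (s : Finset P) (hs : IsAntichain (· ≤ ·) (s : Set P))
    (comm : (s : Set P).Pairwise fun p q => Commute (toggle p) (toggle q)) (A : Antichains P)
    (x : P) :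
    x ∈ ((s.noncommProd toggle comm) A).1 ↔
      (x ∉ s ∧ x ∈ A.1) ∨ (x ∈ s ∧ x ∉ A.1 ∧ ∀ b ∈ A.1, ¬ x ≤ b ∧ ¬ b ≤ x) := by
  classical
  induction s using Finset.induction_on generalizing x with
  | empty =>
    rw [Finset.noncommProd_empty]
    simp only [Finset.notMem_empty, not_false_eq_true, true_and, false_and, or_false]
    exact Iff.rfl
  | insert p s hp ih =>
    rw [Finset.noncommProd_insert_of_notMem _ _ _ _ hp]
    have hs' : IsAntichain (· ≤ ·) (s : Set P) :=
      hs.subset (Finset.coe_subset.mpr (Finset.subset_insert p s))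
    have ih' := ih hs' (comm.mono (Finset.coe_subset.mpr (Finset.subset_insert p s)))
    have hinc : ∀ q ∈ s, ¬ p ≤ q ∧ ¬ q ≤ p := fun q hq => by
      have hpq : p ≠ q := fun h => hp (h ▸ hq)
      have hp1 : p ∈ ((insert p s : Finset P) : Set P) := by simp
      have hq1 : q ∈ ((insert p s : Finset P) : Set P) := by simp [hq]
      exact ⟨hs hp1 hq1 hpq, hs hq1 hp1 hpq.symm⟩
    change x ∈ (toggle p ((s.noncommProd toggle _) A)).1 ↔ _
    rw [mem_toggle]
    simp only [ih', Finset.mem_insert]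
    grind

variable [Fintype P] [GradeMinOrder ℕ P]

theorem mem_rankToggle (i : ℕ) (A : Antichains P) (x : P) :
    x ∈ (rankToggle P i A).1 ↔
      (grade ℕ x ≠ i ∧ x ∈ A.1) ∨
        (grade ℕ x = i ∧ x ∉ A.1 ∧ ∀ b ∈ A.1, ¬ x ≤ b ∧ ¬ b ≤ x) := by
  unfold rankToggle
  refine (mem_noncommProd_toggle _ ?_ _ A x).trans (by simp)
  · intro p hp q hq hpq h
    have hp' : grade ℕ p = i := (Finset.mem_filter.mp (Finset.mem_coe.mp hp)).2
    have hq' : grade ℕ q = i := (Finset.mem_filter.mp (Finset.mem_coe.mp hq)).2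
    have := grade_strictMono (𝕆 := ℕ) (lt_of_le_of_ne h hpq)
    omega

/-- The elements of rank at least `k` in the image of `A` under the rank toggles of rank at
least `k`, applied from the bottom up. -/
def PartialRow (k : ℕ) (A : Antichains P) (x : P) : Prop :=
  k ≤ grade ℕ x ∧ (∀ a ∈ A.1, ¬ x ≤ a) ∧ (∀ a ∈ A.1, grade ℕ a < k → ¬ a ≤ x) ∧
    ∀ z, z < x → k ≤ grade ℕ z → ∃ a ∈ A.1, z ≤ a

/-- Descend from `x` as long as some smaller element of rank at least `k` is not below `A`; the
hypotheses pass to smaller elements, and the rank bounds the descent. -/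
theorem exists_partialRow_le {k : ℕ} {A : Antichains P} {x : P} (hk : k ≤ grade ℕ x)
    (h1 : ∀ a ∈ A.1, ¬ x ≤ a) (h2 : ∀ a ∈ A.1, grade ℕ a < k → ¬ a ≤ x) :
    ∃ z, z ≤ x ∧ PartialRow k A z := by
  induction hx : grade ℕ x using Nat.strong_induction_on generalizing x with
  | _ m ih =>
    by_cases h3 : ∀ z, z < x → k ≤ grade ℕ z → ∃ a ∈ A.1, z ≤ a
    · exact ⟨x, le_rfl, hk, h1, h2, h3⟩
    · push Not at h3
      obtain ⟨z, hzx, hkz, hz⟩ := h3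
      have hlt := grade_strictMono (𝕆 := ℕ) hzx
      obtain ⟨w, hw, hw'⟩ := ih (grade ℕ z) (by omega) hkz hz
        (fun a ha hak hle => h2 a ha hak (hle.trans hzx.le)) rfl
      exact ⟨w, hw.trans hzx.le, hw'⟩

theorem mem_prod_rankToggle (k m : ℕ) (A : Antichains P) (x : P) :
    x ∈ ((((List.range' k m).reverse.map (rankToggle P)).prod) A).1 ↔
      ((grade ℕ x < k ∨ k + m ≤ grade ℕ x) ∧ x ∈ A.1) ∨
        (grade ℕ x < k + m ∧ PartialRow k A x) := by
  induction m generalizing x with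
  | zero =>
    simp only [List.range'_zero, List.reverse_nil, List.map_nil, List.prod_nil]
    change x ∈ A.1 ↔ _
    have : grade ℕ x < k ∨ k + 0 ≤ grade ℕ x := by omega
    simp only [this, true_and, PartialRow]
    constructor
    · exact Or.inl
    · rintro (h | ⟨h, h', -⟩)
      · exact h
      · omega
  | succ m ih =>
    rw [List.range'_1_concat, List.reverse_append, List.reverse_singleton, List.map_append,
      List.prod_append, List.map_singleton, List.prod_singleton]
    change x ∈ (rankToggle P (k + m) ((((List.range' k m).reverse.map (rankToggle P)).prod) A)).1
      ↔ _
    rw [mem_rankToggle]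
    simp only [ih]
    by_cases hx : grade ℕ x = k + m
    · have hP : x ∉ A.1 → (PartialRow k A x ↔ (∀ b, ((grade ℕ b < k ∨ k + m ≤ grade ℕ b) ∧ b ∈ A.1) ∨
        (grade ℕ b < k + m ∧ PartialRow k A b) → ¬ x ≤ b ∧ ¬ b ≤ x)) := by
        intro hxA
        constructor
        · rintro ⟨h0, h1, h2, h3⟩ b (⟨hb, hbA⟩ | ⟨hb, hbA⟩)
          · refine ⟨h1 b hbA, fun hle => ?_⟩
            rcases hb with hb | hb
            · exact h2 b hbA hb hle
            · have hne : b ≠ x := fun h => hxA (h ▸ hbA)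
              have := grade_strictMono (𝕆 := ℕ) (lt_of_le_of_ne hle hne)
              omega
          · have hne : b ≠ x := fun h => by subst h; omega
            refine ⟨fun hle => ?_, fun hle => ?_⟩
            · have := grade_strictMono (𝕆 := ℕ) (lt_of_le_of_ne hle hne.symm)
              omega
            · obtain ⟨a, ha, hba⟩ := h3 b (lt_of_le_of_ne hle hne) hbA.1
              exact hbA.2.1 a ha hba
        · intro h
          refine ⟨by omega, fun a ha hle => ?_, fun a ha hak => (h a (Or.inl ⟨Or.inl hak, ha⟩)).2, ?_⟩
          · have hne : x ≠ a := fun h => hxA (h ▸ ha)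
            have := grade_strictMono (𝕆 := ℕ) (lt_of_le_of_ne hle hne)
            exact (h a (Or.inl ⟨Or.inr (by omega), ha⟩)).1 hle
          · intro z hzx hkz
            -- Otherwise a `PartialRow` element lies below `z`. Its rank is less than `k + m`, so it
            -- has already been toggled in, and it blocks `x`.
            by_contra hz
            push Not at hz
            have hlt := grade_strictMono (𝕆 := ℕ) hzx
            obtain ⟨w, hw, hw'⟩ := exists_partialRow_le hkz hz
              (fun a ha hak hle => (h a (Or.inl ⟨Or.inl hak, ha⟩)).2 (hle.trans hzx.le))
            have hlt' := grade_mono (𝕆 := ℕ) hw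
            exact (h w (Or.inr ⟨by omega, hw'⟩)).2 (hw.trans hzx.le)
      have hA : PartialRow k A x → x ∉ A.1 := fun h hxA => h.2.1 x hxA le_rfl
      have e1 : ¬ (grade ℕ x < k ∨ k + (m + 1) ≤ grade ℕ x) := by omega
      have e2 : (grade ℕ x < k ∨ k + m ≤ grade ℕ x) := by omega
      have e3 : ¬ (grade ℕ x < k + m) := by omega
      have e4 : (grade ℕ x < k + (m + 1)) := by omega
      simp only [hx, ne_eq, not_true_eq_false, false_and, true_and, false_or]
      simp only [hx] at *
      tauto
    · have e1 : (grade ℕ x < k ∨ k + (m + 1) ≤ grade ℕ x) ↔ (grade ℕ x < k ∨ k + m ≤ grade ℕ x) := by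
        omega
      have e2 : grade ℕ x < k + (m + 1) ↔ grade ℕ x < k + m := by omega
      simp only [hx, e1, e2, ne_eq, not_false_eq_true, true_and, false_and, or_false]

theorem grade_le_posetRank (x : P) : grade ℕ x ≤ posetRank P :=
  Finset.le_sup (f := fun p : P => grade ℕ p) (Finset.mem_univ x)

theorem mem_rankTogglesFrom {k : ℕ} (hk : k ≤ posetRank P) (A : Antichains P) (x : P) :
    x ∈ (rankTogglesFrom P k A).1 ↔ (grade ℕ x < k ∧ x ∈ A.1) ∨ PartialRow k A x := by
  have := grade_le_posetRank x
  have e1 : (grade ℕ x < k ∨ k + (posetRank P + 1 - k) ≤ grade ℕ x) ↔ grade ℕ x < k := by omega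
  have e2 : grade ℕ x < k + (posetRank P + 1 - k) := by omega
  unfold rankTogglesFrom
  rw [mem_prod_rankToggle]
  simp only [e1, e2, true_and]

/-- The factors of rowvacuation that only involve toggles of rank at least `k`. -/
noncomputable def RvacFrom (P : Type*) [PartialOrder P] [Fintype P] [GradeMinOrder ℕ P] (k : ℕ) :
    Function.End (Antichains P) :=
  ((List.range' k (posetRank P + 1 - k)).reverse.map (rankTogglesFrom P)).prod

theorem RvacFrom_of_lt {k : ℕ} (hk : posetRank P < k) (A : Antichains P) :
    RvacFrom P k A = A := by
  unfold RvacFrom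
  rw [show posetRank P + 1 - k = 0 by omega]
  rfl

theorem RvacFrom_of_le {k : ℕ} (hk : k ≤ posetRank P) (A : Antichains P) :
    RvacFrom P k A = RvacFrom P (k + 1) (rankTogglesFrom P k A) := by
  unfold RvacFrom
  rw [show posetRank P + 1 - k = (posetRank P + 1 - (k + 1)) + 1 by omega, List.range'_succ,
    List.reverse_cons, List.map_append, List.prod_append, List.map_singleton, List.prod_singleton]
  rfl

theorem RvacFrom_zero (A : Antichains P) : RvacFrom P 0 A = Rvac A := by
  unfold RvacFrom Rvac
  rw [List.range_eq_range']
  rfl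

end Poset
-- Endpoints of the intervals of `Rvac A` and `row A`.
section RootPoset

variable {n : ℕ}

theorem RootA.le_iff (a b : RootA n) : a ≤ b ↔ b.lo ≤ a.lo ∧ a.hi ≤ b.hi := Iff.rfl

theorem RootA.lt_iff (a b : RootA n) :
    a < b ↔ b.lo ≤ a.lo ∧ a.hi ≤ b.hi ∧ (b.lo < a.lo ∨ a.hi < b.hi) := by
  rw [lt_iff_le_not_ge, RootA.le_iff, RootA.le_iff]
  omega

theorem RootA.grade_eq (a : RootA n) : grade ℕ a = a.hi - a.lo - 1 := rfl

/-- `i` is the left end of an interval in `A`. -/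
def IsLeft (A : Antichains (RootA n)) (i : ℕ) : Prop := ∃ a ∈ A.1, a.lo = i

/-- `j` is the right end of an interval in `A`. -/
def IsRight (A : Antichains (RootA n)) (j : ℕ) : Prop := ∃ a ∈ A.1, a.hi = j

theorem lo_lt_lo_iff {A : Antichains (RootA n)} {a b : RootA n} (ha : a ∈ A.1) (hb : b ∈ A.1) :
    a.lo < b.lo ↔ a.hi < b.hi := by
  by_cases h : a = b
  · subst h; omega
  · have h1 : ¬ a ≤ b := A.2 ha hb h
    have h2 : ¬ b ≤ a := A.2 hb ha (Ne.symm h)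
    rw [RootA.le_iff] at h1 h2
    omega

theorem eq_of_lo_eq {A : Antichains (RootA n)} {a b : RootA n} (ha : a ∈ A.1) (hb : b ∈ A.1)
    (h : a.lo = b.lo) : a = b := by
  have h1 := lo_lt_lo_iff ha hb
  have h2 := lo_lt_lo_iff hb ha
  exact RootA.ext h (by omega)

theorem eq_of_hi_eq {A : Antichains (RootA n)} {a b : RootA n} (ha : a ∈ A.1) (hb : b ∈ A.1)
    (h : a.hi = b.hi) : a = b := by
  have h1 := lo_lt_lo_iff ha hb
  have h2 := lo_lt_lo_iff hb ha
  exact RootA.ext (by omega) h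

/-- The interval `[x, x + k + 1]` exists and contains no interval of `A` of rank less than `k`. -/
def IsFree (k : ℕ) (A : Antichains (RootA n)) (x : ℕ) : Prop :=
  1 ≤ x ∧ x + k + 1 ≤ n ∧
    ∀ a ∈ A.1, grade ℕ a < k → ¬ (x ≤ a.lo ∧ a.hi ≤ x + k + 1)

/-- `[x, y]` is contained in an interval of `A` of rank at least `k`. -/
def IsCovered (k : ℕ) (A : Antichains (RootA n)) (x y : ℕ) : Prop :=
  ∃ a ∈ A.1, k ≤ grade ℕ a ∧ a.lo ≤ x ∧ y ≤ a.hi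

/-- A low-rank interval of `A` inside `[x, x + k + 1]` would lie inside the covering interval, which
also belongs to the antichain. -/
theorem IsCovered.isFree {k : ℕ} {A : Antichains (RootA n)} {x y : ℕ} (h : IsCovered k A x y)
    (hxy : x + k + 1 ≤ y) : IsFree k A x := by
  obtain ⟨a, ha, hk, h1, h2⟩ := h
  have := a.one_le
  have := a.le_n
  refine ⟨by omega, by omega, fun b hb hbk hle => ?_⟩
  have hne : b ≠ a := fun e => by subst e; omega
  exact A.2 hb ha hne ((RootA.le_iff _ _).mpr ⟨by omega, by omega⟩)

/-- Covering passes to subintervals, so minimality need only be tested on the two maximal proper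
subintervals. Their rank is one less than that of `x`, hence at least `k` only when `x.lo + k + 1 <
x.hi`. -/
theorem partialRow_iff {k : ℕ} {A : Antichains (RootA n)} {x : RootA n} :
    PartialRow k A x ↔ x.lo + k + 1 ≤ x.hi ∧ ¬ IsCovered k A x.lo x.hi ∧
      (∀ a ∈ A.1, grade ℕ a < k → ¬ (x.lo ≤ a.lo ∧ a.hi ≤ x.hi)) ∧
      (x.lo + k + 1 < x.hi →
        IsCovered k A (x.lo + 1) x.hi ∧ IsCovered k A x.lo (x.hi - 1)) := by
  have hx := x.lt
  have hx1 := x.one_le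
  have hxn := x.le_n
  have hup : ∀ z : RootA n, k ≤ grade ℕ z →
      ((∃ a ∈ A.1, z ≤ a) ↔ IsCovered k A z.lo z.hi) := by
    intro z hz
    constructor
    · rintro ⟨a, ha, hle⟩
      exact ⟨a, ha, hz.trans (grade_mono (𝕆 := ℕ) hle), hle.1, hle.2⟩
    · rintro ⟨a, ha, -, h1, h2⟩
      exact ⟨a, ha, h1, h2⟩
  have hmono : ∀ {u v u' v'}, IsCovered k A u v → u ≤ u' → v' ≤ v → IsCovered k A u' v' := by
    rintro u v u' v' ⟨a, ha, hk, h1, h2⟩ hu hv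
    exact ⟨a, ha, hk, by omega, by omega⟩
  have hgx := RootA.grade_eq x
  constructor
  · rintro ⟨h0, h1, h2, h3⟩
    refine ⟨by omega, ?_, fun a ha hak hle => h2 a ha hak hle, fun hlt => ⟨?_, ?_⟩⟩
    · rw [← hup x h0]
      rintro ⟨a, ha, hle⟩
      exact h1 a ha hle
    · let z : RootA n := ⟨x.lo + 1, x.hi, by omega, by omega, by omega⟩
      have hz : k ≤ grade ℕ z := by
        rw [RootA.grade_eq]; show k ≤ x.hi - (x.lo + 1) - 1; omega
      exact (hup z hz).mp (h3 z ((RootA.lt_iff _ _).mpr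
        ⟨by show x.lo ≤ x.lo + 1; omega, le_rfl, by left; show x.lo < x.lo + 1; omega⟩) hz)
    · let z : RootA n := ⟨x.lo, x.hi - 1, by omega, by omega, by omega⟩
      have hz : k ≤ grade ℕ z := by
        rw [RootA.grade_eq]; show k ≤ x.hi - 1 - x.lo - 1; omega
      exact (hup z hz).mp (h3 z ((RootA.lt_iff _ _).mpr
        ⟨le_rfl, by show x.hi - 1 ≤ x.hi; omega, by right; show x.hi - 1 < x.hi; omega⟩) hz)
  · rintro ⟨h0, h1, h2, h3⟩
    have hk : k ≤ grade ℕ x := by omega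
    refine ⟨hk, fun a ha hle => h1 ((hup x hk).mp ⟨a, ha, hle⟩), h2, fun z hz hkz => ?_⟩
    rw [hup z hkz]
    rw [RootA.lt_iff] at hz
    have := z.lt
    rw [RootA.grade_eq] at hkz
    obtain ⟨h4, h5⟩ := h3 (by omega)
    rcases hz.2.2 with h | h
    · exact hmono h4 (by omega) (by omega)
    · exact hmono h5 (by omega) (by omega)

/-- The only rank-`k` subintervals of `[x, x + k + 2]` are `[x, x + k + 1]` and `[x + 1, x + k +
2]`. Each is kept out of the toggled antichain, without help from an interval of rank below `k`,
exactly when it is covered. -/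
theorem isFree_succ_rankTogglesFrom {k : ℕ} (hk : k ≤ posetRank (RootA n))
    (A : Antichains (RootA n)) (x : ℕ) :
    IsFree (k + 1) (rankTogglesFrom (RootA n) k A) x ↔
      IsCovered k A x (x + k + 1) ∧ IsCovered k A (x + 1) (x + k + 2) := by
  constructor
  · rintro ⟨h1, hn, h2⟩
    simp only [mem_rankTogglesFrom hk] at h2
    have hlow : ∀ a ∈ A.1, grade ℕ a < k → ¬ (x ≤ a.lo ∧ a.hi ≤ x + (k + 1) + 1) :=
      fun a ha hak => h2 a (Or.inl ⟨hak, ha⟩) (by omega)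
    constructor
    · by_contra hc
      let z : RootA n := ⟨x, x + k + 1, h1, by omega, by omega⟩
      refine h2 z (Or.inr (partialRow_iff.mpr ⟨le_rfl, hc, fun a ha hak hle => ?_,
        fun h => absurd h (lt_irrefl _)⟩)) ?_ ⟨le_rfl, ?_⟩
      · have e1 : x ≤ a.lo := hle.1
        have e2 : a.hi ≤ x + k + 1 := hle.2
        exact hlow a ha hak ⟨e1, by omega⟩
      · rw [RootA.grade_eq]; show x + k + 1 - x - 1 < k + 1; omega
      · show x + k + 1 ≤ _; omega
    · by_contra hc
      let z : RootA n := ⟨x + 1, x + k + 2, by omega, by omega, by omega⟩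
      refine h2 z (Or.inr (partialRow_iff.mpr ⟨?_, hc, fun a ha hak hle => ?_,
        fun h => ?_⟩)) ?_ ⟨?_, ?_⟩
      · show x + 1 + k + 1 ≤ x + k + 2; omega
      · have e1 : x + 1 ≤ a.lo := hle.1
        have e2 : a.hi ≤ x + k + 2 := hle.2
        exact hlow a ha hak ⟨by omega, by omega⟩
      · have e1 : x + 1 + k + 1 < x + k + 2 := h
        omega
      · rw [RootA.grade_eq]; show x + k + 2 - (x + 1) - 1 < k + 1; omega
      · show x ≤ x + 1; omega
      · show x + k + 2 ≤ _; omega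
  · rintro ⟨h1, h2⟩
    have f1 := h1.isFree (by omega)
    have f2 := h2.isFree (by omega)
    refine ⟨f1.1, by have := f2.2.1; omega, fun b hb hbk hle => ?_⟩
    rw [mem_rankTogglesFrom hk] at hb
    rw [RootA.grade_eq] at hbk
    have hblt := b.lt
    rcases hb with ⟨hbk', hb⟩ | hb
    · have f1' := f1.2.2 b hb hbk'
      have f2' := f2.2.2 b hb hbk'
      rw [RootA.grade_eq] at hbk'
      omega
    · obtain ⟨g1, g2, -, -⟩ := partialRow_iff.mp hb
      rcases Nat.eq_or_lt_of_le hle.1 with e | e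
      · apply g2
        rw [← e, show b.hi = x + k + 1 by omega]
        exact h1
      · apply g2
        rw [show b.lo = x + 1 by omega, show b.hi = x + k + 2 by omega]
        exact h2

/-- Transfers right ends of high rank through one pass of toggles: they move up by one.
`exists_lo_partialRow` is the mirror image, where left ends move down. -/
theorem exists_hi_partialRow {k : ℕ} {A : Antichains (RootA n)} {x : ℕ}
    (h2 : IsCovered k A (x + 1) (x + k + 2)) :
    (∃ b, PartialRow k A b ∧ k < grade ℕ b ∧ b.hi = x + k + 2) ↔
      ∃ a ∈ A.1, k ≤ grade ℕ a ∧ a.hi = x + k + 1 := by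
  constructor
  · rintro ⟨b, hb, hbk, hbx⟩
    rw [RootA.grade_eq] at hbk
    obtain ⟨g1, g2, -, g4⟩ := partialRow_iff.mp hb
    obtain ⟨-, a, ha, hak, hal, hah⟩ := g4 (by omega)
    refine ⟨a, ha, hak, ?_⟩
    by_contra hne
    exact g2 ⟨a, ha, hak, hal, by omega⟩
  · rintro ⟨a, ha, hak, hax⟩
    obtain ⟨c, hc, hck, hcl, hch⟩ := h2
    classical
    have hex : ∃ g, IsCovered k A g (x + k + 2) := ⟨_, c, hc, hck, hcl, hch⟩
    obtain ⟨c', hc', hck', hcl', hch'⟩ := Nat.find_spec hex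
    have hmin := fun m => Nat.find_min hex (m := m)
    have hle := Nat.find_min' hex ⟨c, hc, hck, hcl, hch⟩
    -- With `g` the least left end for which `[g, x + k + 2]` is covered, the minimal uncovered
    -- interval is `[g - 1, x + k + 2]`.
    set g := Nat.find hex with hg
    have hac : a.lo < c'.lo := (lo_lt_lo_iff ha hc').mpr (by omega)
    have := a.one_le
    have hcn := c'.le_n
    let b : RootA n := ⟨g - 1, x + k + 2, by omega, by omega, by omega⟩
    have hbl : b.lo = g - 1 := rfl
    have hbh : b.hi = x + k + 2 := rfl
    have hC2 : IsCovered k A (b.lo + 1) b.hi := by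
      rw [hbl, hbh]; exact ⟨c', hc', hck', by omega, hch'⟩
    have hC1 : IsCovered k A b.lo (b.hi - 1) := by
      rw [hbl, hbh]; exact ⟨a, ha, hak, by omega, by omega⟩
    refine ⟨b, partialRow_iff.mpr ⟨by omega, hmin _ (by omega), fun d hd hdk hle => ?_,
      fun _ => ⟨hC2, hC1⟩⟩, ?_, rfl⟩
    -- Here `a` contains `[g - 1, x + k + 1]` and `c'` contains `[g, x + k + 2]`. A `d` inside `b`
    -- but in neither must be `b` itself, whose rank is too large.
    · have hda : ¬ d ≤ a := A.2 hd ha (fun e => by subst e; omega)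
      have hdc : ¬ d ≤ c' := A.2 hd hc' (fun e => by subst e; omega)
      rw [RootA.le_iff] at hda hdc
      rw [RootA.grade_eq] at hdk
      omega
    · rw [RootA.grade_eq]; omega

theorem exists_lo_partialRow {k : ℕ} {A : Antichains (RootA n)} {x : ℕ}
    (h1 : IsCovered k A x (x + k + 1)) :
    (∃ b, PartialRow k A b ∧ k < grade ℕ b ∧ b.lo = x) ↔
      ∃ a ∈ A.1, k ≤ grade ℕ a ∧ a.lo = x + 1 := by
  constructor
  · rintro ⟨b, hb, hbk, hbx⟩
    rw [RootA.grade_eq] at hbk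
    obtain ⟨g1, g2, -, g4⟩ := partialRow_iff.mp hb
    obtain ⟨⟨a, ha, hak, hal, hah⟩, -⟩ := g4 (by omega)
    refine ⟨a, ha, hak, ?_⟩
    by_contra hne
    exact g2 ⟨a, ha, hak, by omega, hah⟩
  · rintro ⟨a, ha, hak, hax⟩
    classical
    have hbd : ∀ y, IsCovered k A x y → y ≤ n := by
      rintro y ⟨c, -, -, -, hc⟩
      exact hc.trans c.le_n
    obtain ⟨c', hc', hck', hcl', hch'⟩ := Nat.findGreatest_spec (hbd _ h1) h1
    have hmax := fun y => Nat.findGreatest_is_greatest (P := IsCovered k A x) (n := n) (k := y)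
    have hle := Nat.le_findGreatest (hbd _ h1) h1
    set g := Nat.findGreatest (IsCovered k A x) n with hg
    have hac : c'.hi < a.hi := (lo_lt_lo_iff hc' ha).mp (by omega)
    have := c'.one_le
    have han := a.le_n
    let b : RootA n := ⟨x, g + 1, by omega, by omega, by omega⟩
    have hbl : b.lo = x := rfl
    have hbh : b.hi = g + 1 := rfl
    have hC2 : IsCovered k A (b.lo + 1) b.hi := by
      rw [hbl, hbh]; exact ⟨a, ha, hak, by omega, by omega⟩
    have hC1 : IsCovered k A b.lo (b.hi - 1) := by
      rw [hbl, hbh]; exact ⟨c', hc', hck', by omega, by omega⟩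
    refine ⟨b, partialRow_iff.mpr ⟨by omega, hmax _ (by omega) (by omega), fun d hd hdk hle => ?_,
      fun _ => ⟨hC2, hC1⟩⟩, ?_, rfl⟩
    · have hda : ¬ d ≤ a := A.2 hd ha (fun e => by subst e; omega)
      have hdc : ¬ d ≤ c' := A.2 hd hc' (fun e => by subst e; omega)
      rw [RootA.le_iff] at hda hdc
      rw [RootA.grade_eq] at hdk
      omega
    · rw [RootA.grade_eq]; omega

theorem partialRow_grade_eq {k : ℕ} {A : Antichains (RootA n)} {b : RootA n}
    (hb : grade ℕ b = k) :
    PartialRow k A b ↔ IsFree k A b.lo ∧ ¬ IsCovered k A b.lo (b.lo + k + 1) := by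
  have h1 := b.lt
  have h2 := b.one_le
  have h3 := b.le_n
  rw [RootA.grade_eq] at hb
  rw [partialRow_iff, show b.hi = b.lo + k + 1 by omega]
  constructor
  · rintro ⟨-, h, h', -⟩
    exact ⟨⟨h2, by omega, h'⟩, h⟩
  · rintro ⟨⟨-, -, h'⟩, h⟩
    exact ⟨le_rfl, h, h', fun h => absurd h (lt_irrefl _)⟩

/-- The rank bound `k` is what makes the induction close: the first pass fixes the elements of rank
`k` for good, and the later passes act as the same operator with `k + 1`. Ends of rank exactly `k`
account for the uncovered `[x, x + k + 1]`, ends of higher rank for the covered ones. -/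
theorem RvacFrom_spec (k : ℕ) (A : Antichains (RootA n)) :
    (∀ b : RootA n, grade ℕ b < k → (b ∈ (RvacFrom (RootA n) k A).1 ↔ b ∈ A.1)) ∧
    (∀ x, (∃ b ∈ (RvacFrom (RootA n) k A).1, k ≤ grade ℕ b ∧ b.lo = x) ↔
      IsFree k A x ∧ ¬ ∃ a ∈ A.1, k ≤ grade ℕ a ∧ a.hi = x + k + 1) ∧
    (∀ x, (∃ b ∈ (RvacFrom (RootA n) k A).1, k ≤ grade ℕ b ∧ b.hi = x + k + 1) ↔
      IsFree k A x ∧ ¬ ∃ a ∈ A.1, k ≤ grade ℕ a ∧ a.lo = x) := by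
  induction hm : posetRank (RootA n) + 1 - k generalizing k A with
  | zero =>
    rw [RvacFrom_of_lt (by omega)]
    have hg : ∀ b : RootA n, ¬ k ≤ grade ℕ b := fun b => by
      have := grade_le_posetRank b
      omega
    have hf : ∀ x, ¬ IsFree k A x := by
      rintro x ⟨h1, h2, -⟩
      apply hg ⟨x, x + k + 1, h1, by omega, h2⟩
      rw [RootA.grade_eq]
      show k ≤ x + k + 1 - x - 1
      omega
    simp [hg, hf]
  | succ m ih =>
    have hk : k ≤ posetRank (RootA n) := by omega
    rw [RvacFrom_of_le hk]
    obtain ⟨ih0, ih1, ih2⟩ := ih (k + 1) (rankTogglesFrom (RootA n) k A) (by omega)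
    set B := rankTogglesFrom (RootA n) k A with hB
    set R := RvacFrom (RootA n) (k + 1) B with hR
    have hmemB : ∀ b, b ∈ B.1 ↔ (grade ℕ b < k ∧ b ∈ A.1) ∨ PartialRow k A b :=
      fun b => mem_rankTogglesFrom hk A b
    have hPk : ∀ b, PartialRow k A b → k ≤ grade ℕ b := fun b h => h.1
    have hmemR : ∀ b : RootA n, grade ℕ b = k →
        (b ∈ R.1 ↔ IsFree k A b.lo ∧ ¬ IsCovered k A b.lo (b.lo + k + 1)) := by
      intro b hb
      rw [ih0 b (by omega), hmemB, ← partialRow_grade_eq hb]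
      constructor
      · rintro (h | h)
        · omega
        · exact h
      · exact Or.inr
    have hBhigh : ∀ (p : RootA n → Prop), (∃ a ∈ B.1, k + 1 ≤ grade ℕ a ∧ p a) ↔
        ∃ b, PartialRow k A b ∧ k < grade ℕ b ∧ p b := by
      intro p
      constructor
      · rintro ⟨a, ha, hak, hp⟩
        rcases (hmemB a).mp ha with h | h
        · omega
        · exact ⟨a, h, hak, hp⟩
      · rintro ⟨a, ha, hak, hp⟩
        exact ⟨a, (hmemB a).mpr (Or.inr ha), hak, hp⟩
    have hsplit : ∀ (p : RootA n → Prop), (∃ b ∈ R.1, k ≤ grade ℕ b ∧ p b) ↔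
        (∃ b ∈ R.1, grade ℕ b = k ∧ p b) ∨ ∃ b ∈ R.1, k + 1 ≤ grade ℕ b ∧ p b := by
      intro p
      constructor
      · rintro ⟨b, hb, hbk, hp⟩
        rcases Nat.eq_or_lt_of_le hbk with e | e
        · exact Or.inl ⟨b, hb, e.symm, hp⟩
        · exact Or.inr ⟨b, hb, e, hp⟩
      · rintro (⟨b, hb, hbk, hp⟩ | ⟨b, hb, hbk, hp⟩)
        · exact ⟨b, hb, hbk.ge, hp⟩
        · exact ⟨b, hb, by omega, hp⟩
    have hk1 : ∀ x, (∃ b ∈ R.1, grade ℕ b = k ∧ b.lo = x) ↔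
        IsFree k A x ∧ ¬ IsCovered k A x (x + k + 1) := by
      intro x
      constructor
      · rintro ⟨b, hb, hbk, rfl⟩
        exact (hmemR b hbk).mp hb
      · intro h
        have hg : grade ℕ (⟨x, x + k + 1, h.1.1, by omega, h.1.2.1⟩ : RootA n) = k := by
          rw [RootA.grade_eq]; show x + k + 1 - x - 1 = k; omega
        exact ⟨_, (hmemR _ hg).mpr h, hg, rfl⟩
    have hk2 : ∀ x, (∃ b ∈ R.1, grade ℕ b = k ∧ b.hi = x + k + 1) ↔
        IsFree k A x ∧ ¬ IsCovered k A x (x + k + 1) := by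
      intro x
      rw [← hk1]
      have : ∀ b : RootA n, grade ℕ b = k → (b.hi = x + k + 1 ↔ b.lo = x) := fun b hb => by
        have := b.lt
        rw [RootA.grade_eq] at hb
        omega
      constructor
      · rintro ⟨b, hb, hbk, h⟩
        exact ⟨b, hb, hbk, (this b hbk).mp h⟩
      · rintro ⟨b, hb, hbk, h⟩
        exact ⟨b, hb, hbk, (this b hbk).mpr h⟩
    have hnest : ∀ a ∈ A.1, k ≤ grade ℕ a → ∀ x, ¬ IsCovered k A x (x + k + 1) →
        a.lo ≠ x ∧ a.hi ≠ x + k + 1 := by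
      intro a ha hak x hx
      have hak' := hak
      rw [RootA.grade_eq] at hak'
      have := a.lt
      constructor
      · intro h
        exact hx ⟨a, ha, hak, by omega, by omega⟩
      · intro h
        exact hx ⟨a, ha, hak, by omega, by omega⟩
    refine ⟨fun b hb => ?_, fun x => ?_, fun x => ?_⟩
    · rw [ih0 b (by omega), hmemB]
      constructor
      · rintro (h | h)
        · exact h.2
        · have := hPk b h
          omega
      · exact fun h => Or.inl ⟨hb, h⟩
    · rw [hsplit, hk1, ih1, isFree_succ_rankTogglesFrom hk, hBhigh]
      constructor
      · rintro (⟨h1, h2⟩ | ⟨⟨h1, h2⟩, h3⟩)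
        · exact ⟨h1, fun ⟨a, ha, hak, hax⟩ => (hnest a ha hak x h2).2 hax⟩
        · exact ⟨h1.isFree (by omega), fun h => h3 ((exists_hi_partialRow h2).mpr h)⟩
      · rintro ⟨h1, h2⟩
        by_cases hc : IsCovered k A x (x + k + 1)
        · right
          -- The interval covering `[x, x + k + 1]` does not end at `x + k + 1`, so it reaches one
          -- step further.
          have hc2 : IsCovered k A (x + 1) (x + k + 2) := by
            obtain ⟨a, ha, hak, hal, hah⟩ := hc
            refine ⟨a, ha, hak, by omega, ?_⟩
            by_contra hne
            exact h2 ⟨a, ha, hak, by omega⟩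
          exact ⟨⟨hc, hc2⟩, fun h => h2 ((exists_hi_partialRow hc2).mp h)⟩
        · exact Or.inl ⟨h1, hc⟩
    · rw [hsplit, hk2]
      constructor
      · rintro (⟨h1, h2⟩ | ⟨b, hb, hbk, hbx⟩)
        · exact ⟨h1, fun ⟨a, ha, hak, hax⟩ => (hnest a ha hak x h2).1 hax⟩
        · have hbl := b.lt
          have hb1 := b.one_le
          have hbk' := hbk
          rw [RootA.grade_eq] at hbk'
          -- The induction hypothesis for right ends is read at `y = x - 1`, since `x + k + 1 = y +
          -- (k + 1) + 1`.
          obtain ⟨y, rfl⟩ : ∃ y, x = y + 1 := ⟨x - 1, by omega⟩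
          obtain ⟨h1, h2⟩ := (ih2 y).mp ⟨b, hb, hbk, by omega⟩
          rw [isFree_succ_rankTogglesFrom hk] at h1
          rw [hBhigh] at h2
          refine ⟨h1.2.isFree (by omega), fun h => h2 ((exists_lo_partialRow h1.1).mpr h)⟩
      · rintro ⟨h1, h2⟩
        by_cases hc : IsCovered k A x (x + k + 1)
        · right
          obtain ⟨a, ha, hak, hal, hah⟩ := id hc
          have hax : a.lo ≠ x := fun h => h2 ⟨a, ha, hak, h⟩
          obtain ⟨y, rfl⟩ : ∃ y, x = y + 1 := ⟨x - 1, by omega⟩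
          have hc1 : IsCovered k A y (y + k + 1) := ⟨a, ha, hak, by omega, by omega⟩
          have hc2 : IsCovered k A (y + 1) (y + k + 2) := ⟨a, ha, hak, by omega, by omega⟩
          have := (ih2 y).mpr ⟨(isFree_succ_rankTogglesFrom hk A y).mpr ⟨hc1, hc2⟩, by
            rw [hBhigh]; exact fun h => h2 ((exists_lo_partialRow hc1).mp h)⟩
          obtain ⟨b, hb, hbk, hbx⟩ := this
          exact ⟨b, hb, hbk, by omega⟩
        · exact Or.inl ⟨h1, hc⟩

theorem isFree_zero {A : Antichains (RootA n)} {x : ℕ} : IsFree 0 A x ↔ 1 ≤ x ∧ x + 1 ≤ n := by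
  simp [IsFree]

theorem isLeft_Rvac (A : Antichains (RootA n)) (x : ℕ) :
    IsLeft (Rvac A) x ↔ (1 ≤ x ∧ x + 1 ≤ n) ∧ ¬ IsRight A (x + 1) := by
  have := (RvacFrom_spec 0 A).2.1 x
  simpa [RvacFrom_zero, isFree_zero, IsLeft, IsRight] using this

theorem isRight_Rvac (A : Antichains (RootA n)) (x : ℕ) :
    IsRight (Rvac A) (x + 1) ↔ (1 ≤ x ∧ x + 1 ≤ n) ∧ ¬ IsLeft A x := by
  have := (RvacFrom_spec 0 A).2.2 x
  simpa [RvacFrom_zero, isFree_zero, IsLeft, IsRight] using this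

theorem mem_row (A : Antichains (RootA n)) (b : RootA n) :
    b ∈ (row A).1 ↔ PartialRow 0 A b := by
  simp only [row, Finset.mem_filter, Finset.mem_univ, true_and, PartialRow, zero_le,
    not_lt_zero, false_imp_iff, imp_true_iff, true_imp_iff, minimal_iff_forall_lt]
  simp only [not_forall, not_not, exists_prop]

/-- No interval of `A` contains `[x, x + 1]`. -/
def IsSplit (A : Antichains (RootA n)) (x : ℕ) : Prop :=
  ∀ a ∈ A.1, ¬ (a.lo ≤ x ∧ x < a.hi)

theorem isSplit_iff {A : Antichains (RootA n)} {x : ℕ} :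
    IsSplit A x ↔ ¬ IsCovered 0 A x (x + 1) := by
  simp [IsSplit, IsCovered]

theorem partialRow_zero_of_isSplit {A : Antichains (RootA n)} {b : RootA n}
    (h : IsSplit A b.lo) (hb : b.hi = b.lo + 1) : PartialRow 0 A b := by
  rw [partialRow_grade_eq (by rw [RootA.grade_eq]; omega), isFree_zero]
  have := b.one_le
  have := b.le_n
  exact ⟨⟨by omega, by omega⟩, isSplit_iff.mp h⟩

/-- If `A` splits at `x`, the interval `[x, x + 1]` is itself minimal among those not below `A`;
otherwise `[x, x + 1]` is covered and the transfer of ends applies with `k = 0`. -/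
theorem isLeft_row (A : Antichains (RootA n)) (x : ℕ) :
    IsLeft (row A) x ↔ (1 ≤ x ∧ x + 1 ≤ n) ∧ (IsLeft A (x + 1) ∨ IsSplit A x) := by
  constructor
  · rintro ⟨b, hb, rfl⟩
    have h1 := b.one_le
    have h2 := b.lt
    have h3 := b.le_n
    rw [mem_row, partialRow_iff] at hb
    obtain ⟨-, g2, -, g4⟩ := hb
    refine ⟨⟨h1, by omega⟩, ?_⟩
    by_cases h : b.hi = b.lo + 1
    · right
      rw [h] at g2
      exact isSplit_iff.mpr g2
    · left
      obtain ⟨⟨a, ha, hak, hal, hah⟩, -⟩ := g4 (by omega)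
      refine ⟨a, ha, ?_⟩
      by_contra hne
      exact g2 ⟨a, ha, hak, by omega, hah⟩
  · rintro ⟨⟨h1, h2⟩, h⟩
    by_cases hs : IsSplit A x
    · exact ⟨⟨x, x + 1, h1, by omega, h2⟩, (mem_row _ _).mpr (partialRow_zero_of_isSplit hs rfl), rfl⟩
    · have hc := not_not.mp (mt isSplit_iff.mpr hs)
      obtain ⟨a, ha, hax⟩ := h.resolve_right hs
      obtain ⟨b, hb, -, hbx⟩ := (exists_lo_partialRow hc).mpr ⟨a, ha, Nat.zero_le _, hax⟩
      exact ⟨b, (mem_row _ _).mpr hb, hbx⟩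

theorem isRight_row (A : Antichains (RootA n)) (x : ℕ) :
    IsRight (row A) (x + 1) ↔ (1 ≤ x ∧ x + 1 ≤ n) ∧ (IsRight A x ∨ IsSplit A x) := by
  constructor
  · rintro ⟨b, hb, hbx⟩
    have h1 := b.one_le
    have h2 := b.lt
    have h3 := b.le_n
    rw [mem_row, partialRow_iff] at hb
    obtain ⟨-, g2, -, g4⟩ := hb
    refine ⟨⟨by omega, by omega⟩, ?_⟩
    by_cases h : b.lo = x
    · right
      rw [h, hbx] at g2
      exact isSplit_iff.mpr g2
    · left
      obtain ⟨-, a, ha, hak, hal, hah⟩ := g4 (by omega)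
      refine ⟨a, ha, ?_⟩
      by_contra hne
      exact g2 ⟨a, ha, hak, by omega, by omega⟩
  · rintro ⟨⟨h1, h2⟩, h⟩
    by_cases hs : IsSplit A x
    · exact ⟨⟨x, x + 1, h1, by omega, h2⟩, (mem_row _ _).mpr (partialRow_zero_of_isSplit hs rfl), rfl⟩
    · have hc := not_not.mp (mt isSplit_iff.mpr hs)
      obtain ⟨a, ha, hax⟩ := h.resolve_right hs
      obtain ⟨y, rfl⟩ : ∃ y, x = y + 1 := ⟨x - 1, by omega⟩
      obtain ⟨b, hb, -, hbx⟩ := (exists_hi_partialRow (k := 0) hc).mpr ⟨a, ha, Nat.zero_le _, hax⟩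
      exact ⟨b, (mem_row _ _).mpr hb, hbx⟩

end RootPoset
-- Noncrossing matchings, and their reflection and rotation.
section Matching

/-- The order in which the positions are swept: `0, -1, 1, -2, 2, …`. With `j^(0)` at position
`j - 1` and `i^(1)` at position `-i`, this is the order `1^(0), 1^(1), 2^(0), 2^(1), …`. -/
def sweep (p : ℤ) : ℤ := if 0 ≤ p then 2 * p else -2 * p - 1

theorem sweep_lt_iff {p : ℤ} {x : ℕ} : sweep p < 2 * x ↔ -(x : ℤ) ≤ p ∧ p < x := by
  unfold sweep; split_ifs <;> omega

/-- `f` is a noncrossing perfect matching of the positions `-n, …, n - 1`, in which the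
marked positions are the ends of the edges that are met last in the sweep. -/
structure IsMatching (n : ℕ) (mk : ℤ → Prop) (f : ℤ → ℤ) : Prop where
  le_apply : ∀ {p : ℤ}, -(n : ℤ) ≤ p → p < n → -(n : ℤ) ≤ f p
  apply_lt : ∀ {p : ℤ}, -(n : ℤ) ≤ p → p < n → f p < n
  apply_apply : ∀ {p : ℤ}, -(n : ℤ) ≤ p → p < n → f (f p) = p
  nest : ∀ {p q : ℤ}, -(n : ℤ) ≤ p → p < q → q < f p → p < n → p < f q ∧ f q < f p
  sweep_lt : ∀ {p : ℤ}, -(n : ℤ) ≤ p → p < n → mk p → sweep (f p) < sweep p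
  lt_sweep : ∀ {p : ℤ}, -(n : ℤ) ≤ p → p < n → ¬ mk p → sweep p < sweep (f p)

namespace IsMatching

variable {n : ℕ} {mk : ℤ → Prop} {f : ℤ → ℤ}

theorem mk_iff (h : IsMatching n mk f) {p : ℤ} (h1 : -(n : ℤ) ≤ p) (h2 : p < n) :
    mk p ↔ sweep (f p) < sweep p := by
  refine ⟨h.sweep_lt h1 h2, fun h3 => ?_⟩
  by_contra h4
  have := h.lt_sweep h1 h2 h4
  omega

theorem apply_ne (h : IsMatching n mk f) {p : ℤ} (h1 : -(n : ℤ) ≤ p) (h2 : p < n) :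
    f p ≠ p := by
  intro e
  by_cases hm : mk p
  · have := h.sweep_lt h1 h2 hm
    rw [e] at this
    omega
  · have := h.lt_sweep h1 h2 hm
    rw [e] at this
    omega

theorem mk_apply (h : IsMatching n mk f) {p : ℤ} (h1 : -(n : ℤ) ≤ p) (h2 : p < n) :
    mk (f p) ↔ ¬ mk p := by
  rw [h.mk_iff (h.le_apply h1 h2) (h.apply_lt h1 h2), h.apply_apply h1 h2]
  constructor
  · intro h3 h4
    have := h.sweep_lt h1 h2 h4
    omega
  · exact h.lt_sweep h1 h2

open Classical in
theorem two_mul_card (h : IsMatching n mk f) {a b : ℤ} (ha : -(n : ℤ) ≤ a) (hb : b ≤ n)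
    (hS : ∀ p, a ≤ p → p < b → a ≤ f p ∧ f p < b) :
    2 * ((Finset.Ico a b).filter mk).card = (b - a).toNat := by
  have h1 : ((Finset.Ico a b).filter mk).card = ((Finset.Ico a b).filter fun p => ¬ mk p).card := by
    refine Finset.card_bij' (fun p _ => f p) (fun p _ => f p) ?_ ?_ ?_ ?_
    all_goals
      intro p hp
      simp only [Finset.mem_filter, Finset.mem_Ico] at hp ⊢
    · exact ⟨hS p hp.1.1 hp.1.2, by
        rw [h.mk_apply (by omega) (by omega)]; exact not_not.mpr hp.2⟩
    · exact ⟨hS p hp.1.1 hp.1.2, by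
        rw [h.mk_apply (by omega) (by omega)]; exact hp.2⟩
    · exact h.apply_apply (by omega) (by omega)
    · exact h.apply_apply (by omega) (by omega)
  have h2 := Finset.card_filter_add_card_filter_not (s := Finset.Ico a b) mk
  rw [Int.card_Ico] at h2
  omega

open Classical in
theorem two_mul_card_Ico (h : IsMatching n mk f) {p : ℤ} (h1 : -(n : ℤ) ≤ p) (h2 : p < n) :
    2 * ((Finset.Ico (p + 1) (f p)).filter mk).card = (f p - (p + 1)).toNat := by
  have h3 := h.apply_lt h1 h2
  refine h.two_mul_card (by omega) (by omega) fun q hq1 hq2 => ?_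
  have := h.nest h1 (show p < q by omega) hq2 h2
  omega

/-- The positions strictly inside an edge are matched among themselves, so their number is even. -/
theorem odd_sub (h : IsMatching n mk f) {p : ℤ} (h1 : -(n : ℤ) ≤ p) (h2 : p < n) :
    Odd (f p - p) := by
  have key : ∀ {p : ℤ}, -(n : ℤ) ≤ p → p < n → p < f p → Odd (f p - p) := by
    intro p h1 h2 h3
    have := h.two_mul_card_Ico h1 h2
    rw [Int.odd_iff]
    omega
  rcases lt_or_gt_of_ne (h.apply_ne h1 h2) with h3 | h3
  · have := key (h.le_apply h1 h2) (h.apply_lt h1 h2) (by rw [h.apply_apply h1 h2]; exact h3)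
    rw [h.apply_apply h1 h2] at this
    rw [Int.odd_iff] at this ⊢
    omega
  · exact key h1 h2 h3

open Classical in
/-- A balanced initial segment of the sweep is a union of edges. -/
theorem closed_of_card (h : IsMatching n mk f) {x : ℕ} (hx : x ≤ n)
    (hc : ((Finset.Ico (-(x : ℤ)) x).filter mk).card = x) {p : ℤ} (h1 : -(x : ℤ) ≤ p)
    (h2 : p < x) : -(x : ℤ) ≤ f p ∧ f p < x := by
  have hmk : ∀ {p : ℤ}, -(x : ℤ) ≤ p → p < x → mk p → -(x : ℤ) ≤ f p ∧ f p < x := by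
    intro p h1 h2 hm
    have h3 := h.sweep_lt (by omega) (by omega) hm
    exact sweep_lt_iff.mp (h3.trans (sweep_lt_iff.mpr ⟨h1, h2⟩))
  by_cases hm : mk p
  · exact hmk h1 h2 hm
  · have h3 := Finset.card_filter_add_card_filter_not (s := Finset.Ico (-(x : ℤ)) x) mk
    rw [Int.card_Ico] at h3
    -- Partners of marked positions come earlier in the sweep, so `f` injects the marked positions
    -- of the segment into its unmarked ones. The numbers agree, so every unmarked position is
    -- reached.
    obtain ⟨q, hq, hqp⟩ := Finset.surj_on_of_inj_on_of_card_le
      (s := (Finset.Ico (-(x : ℤ)) x).filter mk)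
      (t := (Finset.Ico (-(x : ℤ)) x).filter fun p => ¬ mk p) (fun q _ => f q)
      (fun q hq => by
        simp only [Finset.mem_filter, Finset.mem_Ico] at hq ⊢
        refine ⟨hmk hq.1.1 hq.1.2 hq.2, ?_⟩
        rw [h.mk_apply (by omega) (by omega)]
        exact not_not.mpr hq.2)
      (fun q r hq hr e => by
        simp only [Finset.mem_filter, Finset.mem_Ico] at hq hr
        rw [← h.apply_apply (p := q) (by omega) (by omega), e, h.apply_apply (by omega) (by omega)])
      (by omega) p (by simp [h1, h2, hm])
    simp only [Finset.mem_filter, Finset.mem_Ico] at hq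
    rw [hqp, h.apply_apply (by omega) (by omega)]
    exact hq.1

/-- The matching obtained by the reflection `p ↦ -p` modulo `2 * n`. -/
theorem reflect (h : IsMatching n mk f) {mk' : ℤ → Prop} {σ : ℤ → ℤ}
    (hσ : ∀ p, σ p = if p = -(n : ℤ) then -(n : ℤ) else -p)
    (hmk : ∀ p, -(n : ℤ) ≤ p → p < n → (mk' p ↔ mk (σ p))) :
    IsMatching n mk' (fun p => σ (f (σ p))) := by
  have hr : ∀ {p : ℤ}, -(n : ℤ) ≤ p → p < n → -(n : ℤ) ≤ σ p ∧ σ p < n := by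
    intro p h1 h2
    rw [hσ]
    split_ifs <;> omega
  have hσσ : ∀ {p : ℤ}, p < n → σ (σ p) = p := by
    intro p hp
    rw [hσ (σ p), hσ p]
    split_ifs <;> omega
  -- For `0 < p < n` the positions `-p` and `p` are consecutive in the sweep, and `σ` only swaps
  -- such pairs, fixing the first position `0` and the last `-n`. No edge joins `-p` to `p`, by
  -- parity.
  have hsw : ∀ {p : ℤ}, -(n : ℤ) ≤ p → p < n →
      (sweep (σ (f p)) < sweep (σ p) ↔ sweep (f p) < sweep p) := by
    intro p h1 h2
    have h3 := h.le_apply h1 h2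
    have h4 := h.apply_lt h1 h2
    have h5 := h.odd_sub h1 h2
    have h6 := h.apply_ne h1 h2
    rw [Int.odd_iff] at h5
    rw [hσ, hσ]
    unfold sweep
    split_ifs <;> omega
  have hmk' : ∀ {p : ℤ}, -(n : ℤ) ≤ p → p < n → (mk' p ↔ sweep (σ (f (σ p))) < sweep p) := by
    intro p h1 h2
    obtain ⟨h3, h4⟩ := hr h1 h2
    rw [hmk p h1 h2, h.mk_iff h3 h4, ← hsw h3 h4, hσσ h2]
  have hne : ∀ {p : ℤ}, -(n : ℤ) ≤ p → p < n → σ (f (σ p)) ≠ p := by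
    intro p h1 h2 e
    obtain ⟨h3, h4⟩ := hr h1 h2
    apply h.apply_ne h3 h4
    rw [← hσσ (h.apply_lt h3 h4), e]
  refine ⟨fun h1 h2 => ?_, fun h1 h2 => ?_, fun h1 h2 => ?_, ?_, fun h1 h2 => (hmk' h1 h2).mp,
    fun {p} h1 h2 h3 => ?_⟩
  · obtain ⟨h3, h4⟩ := hr h1 h2
    exact (hr (h.le_apply h3 h4) (h.apply_lt h3 h4)).1
  · obtain ⟨h3, h4⟩ := hr h1 h2
    exact (hr (h.le_apply h3 h4) (h.apply_lt h3 h4)).2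
  · obtain ⟨h3, h4⟩ := hr h1 h2
    rw [hσσ (h.apply_lt h3 h4), h.apply_apply h3 h4, hσσ h2]
  · intro p q h1 hpq hq h2
    obtain ⟨h3, h4⟩ := hr h1 h2
    have h5 := h.le_apply h3 h4
    have h6 := h.apply_lt h3 h4
    have h7 := h.apply_apply h3 h4
    have hqn : q ≠ -(n : ℤ) := by omega
    have hfp : f (σ p) ≠ -(n : ℤ) := by
      intro e
      rw [e, hσ] at hq
      simp only [if_true] at hq
      omega
    have e1 : σ (f (σ p)) = -f (σ p) := by rw [hσ, if_neg hfp]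
    have e2 : σ q = -q := by rw [hσ, if_neg hqn]
    simp only [e1, e2] at hq ⊢
    have h8 := h.le_apply (p := -q) (by omega) (by omega)
    have h9 := h.apply_lt (p := -q) (by omega) (by omega)
    have h10 := h.apply_apply (p := -q) (by omega) (by omega)
    -- Since `σ` fixes `-n`, the inside of the new edge at `-n` comes from the outside of the old
    -- one, so nesting is applied contrapositively, to the partner of `-q`.
    by_cases hp : p = -(n : ℤ)
    · have e3 : σ p = -(n : ℤ) := by rw [hσ, if_pos hp]
      rw [e3] at h5 h6 h7 hq hfp ⊢
      have h11 : f (-q) ≠ f (-(n : ℤ)) := by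
        intro e
        rw [e, h7] at h10
        omega
      have h12 : f (-q) ≠ -(n : ℤ) := by
        intro e
        rw [e] at h10
        omega
      have h13 : ¬ f (-q) < f (-(n : ℤ)) := by
        intro hlt
        have := h.nest (p := -(n : ℤ)) (q := f (-q)) le_rfl (by omega) hlt (by omega)
        omega
      rw [hσ, if_neg h12]
      omega
    · have e3 : σ p = -p := by rw [hσ, if_neg hp]
      rw [e3] at h3 h4 h5 h6 h7 hq ⊢
      have := h.nest (p := f (-p)) (q := -q) h5 (by omega) (by omega) h6
      rw [hσ, if_neg (by omega)]
      omega
  · have h4 := mt (hmk' h1 h2).mpr h3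
    have h5 := hne h1 h2
    generalize σ (f (σ p)) = r at *
    unfold sweep at *
    split_ifs at * <;> omega

/-- The matching obtained by the rotation `p ↦ p + 1` modulo `2 * n`. -/
theorem rotate (h : IsMatching n mk f) {mk' : ℤ → Prop} {ρ ρ' : ℤ → ℤ}
    (hρ : ∀ p, ρ p = if p = (n : ℤ) - 1 then -(n : ℤ) else p + 1)
    (hρ' : ∀ p, ρ' p = if p = -(n : ℤ) then (n : ℤ) - 1 else p - 1)
    (hmk : ∀ p, -(n : ℤ) ≤ p → p < n → (mk' (ρ p) ↔ sweep (ρ (f p)) < sweep (ρ p))) :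
    IsMatching n mk' (fun p => ρ (f (ρ' p))) := by
  have hr : ∀ {p : ℤ}, -(n : ℤ) ≤ p → p < n → -(n : ℤ) ≤ ρ p ∧ ρ p < n := by
    intro p h1 h2
    rw [hρ]
    split_ifs <;> omega
  have hr' : ∀ {p : ℤ}, -(n : ℤ) ≤ p → p < n → -(n : ℤ) ≤ ρ' p ∧ ρ' p < n := by
    intro p h1 h2
    rw [hρ']
    split_ifs <;> omega
  have hρρ' : ∀ {p : ℤ}, -(n : ℤ) ≤ p → p < n → ρ (ρ' p) = p := by
    intro p h1 h2
    rw [hρ, hρ']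
    split_ifs <;> omega
  have hρ'ρ : ∀ {p : ℤ}, -(n : ℤ) ≤ p → p < n → ρ' (ρ p) = p := by
    intro p h1 h2
    rw [hρ', hρ]
    split_ifs <;> omega
  have hmk' : ∀ {p : ℤ}, -(n : ℤ) ≤ p → p < n → (mk' p ↔ sweep (ρ (f (ρ' p))) < sweep p) := by
    intro p h1 h2
    obtain ⟨h3, h4⟩ := hr' h1 h2
    have := hmk (ρ' p) h3 h4
    rwa [hρρ' h1 h2] at this
  have hne : ∀ {p : ℤ}, -(n : ℤ) ≤ p → p < n → ρ (f (ρ' p)) ≠ p := by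
    intro p h1 h2 e
    obtain ⟨h3, h4⟩ := hr' h1 h2
    apply h.apply_ne h3 h4
    rw [← hρ'ρ (h.le_apply h3 h4) (h.apply_lt h3 h4), e]
  refine ⟨fun h1 h2 => ?_, fun h1 h2 => ?_, fun h1 h2 => ?_, ?_, fun h1 h2 => (hmk' h1 h2).mp,
    fun {p} h1 h2 h3 => ?_⟩
  · obtain ⟨h3, h4⟩ := hr' h1 h2
    exact (hr (h.le_apply h3 h4) (h.apply_lt h3 h4)).1
  · obtain ⟨h3, h4⟩ := hr' h1 h2
    exact (hr (h.le_apply h3 h4) (h.apply_lt h3 h4)).2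
  · obtain ⟨h3, h4⟩ := hr' h1 h2
    rw [hρ'ρ (h.le_apply h3 h4) (h.apply_lt h3 h4), h.apply_apply h3 h4, hρρ' h1 h2]
  · intro p q h1 hpq hq h2
    obtain ⟨h3, h4⟩ := hr' h1 h2
    have h5 := h.le_apply h3 h4
    have h6 := h.apply_lt h3 h4
    have h7 := h.apply_apply h3 h4
    have hqn : q ≠ -(n : ℤ) := by omega
    have hfp : f (ρ' p) ≠ (n : ℤ) - 1 := by
      intro e
      simp only [e, hρ, if_true] at hq
      omega
    have e1 : ρ (f (ρ' p)) = f (ρ' p) + 1 := by rw [hρ, if_neg hfp]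
    have e2 : ρ' q = q - 1 := by rw [hρ', if_neg hqn]
    simp only [e1, e2] at hq ⊢
    have h8 := h.le_apply (p := q - 1) (by omega) (by omega)
    have h9 := h.apply_lt (p := q - 1) (by omega) (by omega)
    have h10 := h.apply_apply (p := q - 1) (by omega) (by omega)
    -- The edge at `-n` comes from the one at `n - 1`, where inside and outside are again exchanged.
    by_cases hp : p = -(n : ℤ)
    · have e3 : ρ' p = (n : ℤ) - 1 := by rw [hρ', if_pos hp]
      rw [e3] at h5 h6 h7 hq hfp ⊢
      have h11 : f (q - 1) ≠ f ((n : ℤ) - 1) := by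
        intro e
        rw [e, h7] at h10
        omega
      have h12 : f (q - 1) ≠ (n : ℤ) - 1 := by
        intro e
        rw [e] at h10
        omega
      have h13 : ¬ f ((n : ℤ) - 1) < f (q - 1) := by
        intro hlt
        have := h.nest (p := f ((n : ℤ) - 1)) (q := f (q - 1)) h5 hlt (by omega) h6
        omega
      rw [hρ, if_neg h12]
      omega
    · have e3 : ρ' p = p - 1 := by rw [hρ', if_neg hp]
      rw [e3] at h3 h4 h5 h6 h7 hq ⊢
      have := h.nest (p := p - 1) (q := q - 1) h3 (by omega) (by omega) h4
      rw [hρ, if_neg (by omega)]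
      omega
  · have h4 := mt (hmk' h1 h2).mpr h3
    have h5 := hne h1 h2
    generalize ρ (f (ρ' p)) = r at *
    unfold sweep at *
    split_ifs at * <;> omega

end IsMatching

end Matching
-- Marked positions of an antichain, and how `row` and `Rvac` move them.
section Marks

variable {n : ℕ}

/-- The position `p` carries a marking of the diagram of `A`. -/
def IsMarked (A : Antichains (RootA n)) (p : ℤ) : Prop :=
  if 0 ≤ p then IsRight A (p + 1).toNat else ¬ IsLeft A (-p).toNat

theorem isMarked_natCast (A : Antichains (RootA n)) (x : ℕ) :
    IsMarked A x ↔ IsRight A (x + 1) := by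
  unfold IsMarked
  rw [if_pos (by omega), show ((x : ℤ) + 1).toNat = x + 1 by omega]

theorem isMarked_neg (A : Antichains (RootA n)) {x : ℕ} (hx : 1 ≤ x) :
    IsMarked A (-(x : ℤ)) ↔ ¬ IsLeft A x := by
  unfold IsMarked
  rw [if_neg (by omega), show (-(-(x : ℤ))).toNat = x by omega]

theorem not_isLeft_of_le (A : Antichains (RootA n)) {x : ℕ} (hx : n ≤ x) : ¬ IsLeft A x := by
  rintro ⟨a, -, rfl⟩
  have := a.lt
  have := a.le_n
  omega

theorem not_isRight_of_le (A : Antichains (RootA n)) {x : ℕ} (hx : x ≤ 1) : ¬ IsRight A x := by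
  rintro ⟨a, -, rfl⟩
  have := a.lt
  have := a.one_le
  omega

/-- The number of left ends of `A` that are at most `x`. -/
def numLeft (A : Antichains (RootA n)) (x : ℕ) : ℕ := (A.1.filter fun a => a.lo ≤ x).card

/-- The number of right ends of `A` that are at most `x`. -/
def numRight (A : Antichains (RootA n)) (x : ℕ) : ℕ := (A.1.filter fun a => a.hi ≤ x).card

open Classical in
theorem numLeft_succ (A : Antichains (RootA n)) (x : ℕ) :
    numLeft A (x + 1) = numLeft A x + if IsLeft A (x + 1) then 1 else 0 := by
  unfold numLeft
  split_ifs with h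
  · obtain ⟨a, ha, hax⟩ := h
    rw [← Finset.card_insert_of_notMem (a := a) (by simp [hax])]
    congr 1
    ext b
    simp only [Finset.mem_filter, Finset.mem_insert]
    constructor
    · rintro ⟨hb, hbx⟩
      by_cases e : b.lo = x + 1
      · exact Or.inl (eq_of_lo_eq hb ha (by omega))
      · exact Or.inr ⟨hb, by omega⟩
    · rintro (rfl | ⟨hb, hbx⟩)
      · exact ⟨ha, by omega⟩
      · exact ⟨hb, by omega⟩
  · rw [add_zero]
    congr 1
    refine Finset.filter_congr fun b hb => ⟨fun hbx => ?_, fun hbx => by omega⟩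
    by_contra hne
    exact h ⟨b, hb, by omega⟩

open Classical in
theorem numRight_succ (A : Antichains (RootA n)) (x : ℕ) :
    numRight A (x + 1) = numRight A x + if IsRight A (x + 1) then 1 else 0 := by
  unfold numRight
  split_ifs with h
  · obtain ⟨a, ha, hax⟩ := h
    rw [← Finset.card_insert_of_notMem (a := a) (by simp [hax])]
    congr 1
    ext b
    simp only [Finset.mem_filter, Finset.mem_insert]
    constructor
    · rintro ⟨hb, hbx⟩
      by_cases e : b.hi = x + 1
      · exact Or.inl (eq_of_hi_eq hb ha (by omega))
      · exact Or.inr ⟨hb, by omega⟩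
    · rintro (rfl | ⟨hb, hbx⟩)
      · exact ⟨ha, by omega⟩
      · exact ⟨hb, by omega⟩
  · rw [add_zero]
    congr 1
    refine Finset.filter_congr fun b hb => ⟨fun hbx => ?_, fun hbx => by omega⟩
    by_contra hne
    exact h ⟨b, hb, by omega⟩

open Classical in
theorem card_isMarked (A : Antichains (RootA n)) (u v : ℕ) :
    ((Finset.Ico (-(u : ℤ)) v).filter (IsMarked A)).card + numLeft A u = numRight A v + u := by
  induction u with
  | zero =>
    have h0 : numLeft A 0 = 0 := by
      unfold numLeft
      rw [Finset.card_eq_zero, Finset.filter_eq_empty_iff]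
      intro a _
      have := a.one_le
      omega
    rw [h0]
    induction v with
    | zero =>
      have h1 : numRight A 0 = 0 := by
        unfold numRight
        rw [Finset.card_eq_zero, Finset.filter_eq_empty_iff]
        intro a _
        have := a.lt
        omega
      rw [h1]
      simp
    | succ v ih =>
      have e : Finset.Ico (-((0 : ℕ) : ℤ)) ((v + 1 : ℕ) : ℤ) =
          insert (v : ℤ) (Finset.Ico (-((0 : ℕ) : ℤ)) v) := by
        ext p
        simp only [Finset.mem_Ico, Finset.mem_insert]
        omega
      rw [e, Finset.filter_insert, numRight_succ, ← isMarked_natCast]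
      split_ifs
      · rw [Finset.card_insert_of_notMem (by simp)]
        omega
      · omega
  | succ u ih =>
    have e : Finset.Ico (-((u + 1 : ℕ) : ℤ)) (v : ℤ) =
        insert (-((u + 1 : ℕ) : ℤ)) (Finset.Ico (-(u : ℤ)) v) := by
      ext p
      simp only [Finset.mem_Ico, Finset.mem_insert]
      omega
    have h1 := isMarked_neg A (x := u + 1) (by omega)
    rw [e, Finset.filter_insert, numLeft_succ]
    by_cases h : IsLeft A (u + 1)
    · rw [if_neg (by tauto), if_pos h]
      omega
    · rw [if_pos (by tauto), if_neg h, Finset.card_insert_of_notMem (by simp)]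
      omega

/-- The intervals ending by `x` are among those starting by `x`, and the remaining ones are exactly
those containing `[x, x + 1]`. -/
theorem numRight_eq_numLeft_iff (A : Antichains (RootA n)) (x : ℕ) :
    numRight A x = numLeft A x ↔ IsSplit A x := by
  have hsub : (A.1.filter fun a => a.hi ≤ x) ⊆ A.1.filter fun a => a.lo ≤ x := by
    intro a ha
    simp only [Finset.mem_filter] at ha ⊢
    have := a.lt
    exact ⟨ha.1, by omega⟩
  constructor
  · intro h a ha hax
    have e := Finset.eq_of_subset_of_card_le hsub h.ge
    have h1 : a ∈ A.1.filter fun a => a.lo ≤ x := Finset.mem_filter.mpr ⟨ha, hax.1⟩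
    rw [← e, Finset.mem_filter] at h1
    omega
  · intro h
    unfold numRight numLeft
    congr 1
    refine Finset.Subset.antisymm hsub fun a ha => ?_
    simp only [Finset.mem_filter] at ha ⊢
    have := h a ha.1
    exact ⟨ha.1, by omega⟩

open Classical in
theorem card_isMarked_eq_iff (A : Antichains (RootA n)) (x : ℕ) :
    ((Finset.Ico (-(x : ℤ)) x).filter (IsMarked A)).card = x ↔ IsSplit A x := by
  rw [← numRight_eq_numLeft_iff]
  have := card_isMarked A x x
  omega

variable {A : Antichains (RootA n)} {f : ℤ → ℤ}

/-- The inside of such an edge is `[-x, x)`, which is balanced exactly when `A` splits at `x`.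
Conversely, a balanced `[-x, x)` is closed under `f`, so a marked `-x - 1` can only be joined to
`x`, the one earlier position left. -/
theorem IsMatching.apply_eq_neg_sub_one_iff (h : IsMatching n (IsMarked A) f) {x : ℕ} (hx : x < n) :
    f x = -(x : ℤ) - 1 ↔ IsSplit A x ∧ ¬ IsLeft A (x + 1) := by
  classical
  have hcast : -((x + 1 : ℕ) : ℤ) = -(x : ℤ) - 1 := by push_cast; ring
  constructor
  · intro hf
    have h1 : f (-(x : ℤ) - 1) = x := by rw [← hf, h.apply_apply (by omega) (by omega)]
    constructor
    · have h2 := h.two_mul_card_Ico (p := -(x : ℤ) - 1) (by omega) (by omega)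
      rw [h1, show -(x : ℤ) - 1 + 1 = -x by ring] at h2
      rw [← card_isMarked_eq_iff]
      omega
    · rw [← isMarked_neg A (by omega), hcast, h.mk_iff (by omega) (by omega), h1]
      unfold sweep
      split_ifs <;> omega
  · rintro ⟨hs, hl⟩
    have hcl := fun {p : ℤ} => h.closed_of_card (p := p) hx.le ((card_isMarked_eq_iff A x).mpr hs)
    rw [← isMarked_neg A (by omega), hcast] at hl
    have h1 := h.sweep_lt (by omega) (by omega) hl
    have h2 := h.apply_apply (p := -(x : ℤ) - 1) (by omega) (by omega)
    have h3 : f (-(x : ℤ) - 1) = x := by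
      by_contra hne
      have h4 : -(x : ℤ) ≤ f (-(x : ℤ) - 1) ∧ f (-(x : ℤ) - 1) < x := by
        generalize f (-(x : ℤ) - 1) = r at *
        unfold sweep at h1
        split_ifs at h1 <;> omega
      have h5 := hcl h4.1 h4.2
      omega
    rw [h3] at h2
    exact h2

/-- Reconciles the split at `x + 1` in the rule for right ends of `row A` with the split at `x` in
the description of edges joining `x` and `-x - 1`. -/
theorem isSplit_succ_iff (A : Antichains (RootA n)) {x : ℕ} (h : ¬ IsRight A (x + 1)) :
    IsSplit A (x + 1) ↔ IsSplit A x ∧ ¬ IsLeft A (x + 1) := by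
  constructor
  · intro hs
    refine ⟨fun a ha hax => ?_, fun ⟨a, ha, hax⟩ => ?_⟩
    · have h1 := hs a ha
      have h2 : a.hi ≠ x + 1 := fun e => h ⟨a, ha, e⟩
      omega
    · have := hs a ha
      have := a.lt
      omega
  · rintro ⟨hs, hl⟩ a ha hax
    have h1 := hs a ha
    have h2 : a.lo ≠ x + 1 := fun e => hl ⟨a, ha, e⟩
    omega

theorem IsMatching.isMarked_row_natCast_succ (h : IsMatching n (IsMarked A) f) {x : ℕ}
    (hx : x + 1 < n) :
    IsMarked (row A) ((x : ℤ) + 1) ↔ IsMarked A x ∨ f x = -(x : ℤ) - 1 := by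
  have hc : (x : ℤ) + 1 = (x + 1 : ℕ) := by push_cast; ring
  rw [hc, isMarked_natCast, isMarked_natCast, isRight_row,
    h.apply_eq_neg_sub_one_iff (by omega)]
  have := isSplit_succ_iff A (x := x)
  have h1 : 1 ≤ x + 1 ∧ x + 1 + 1 ≤ n := by omega
  tauto

theorem IsMatching.isMarked_row_neg (h : IsMatching n (IsMarked A) f) {x : ℕ} (hx : x < n) :
    IsMarked (row A) (-(x : ℤ)) ↔ IsMarked A (-(x : ℤ) - 1) ∧ f x ≠ -(x : ℤ) - 1 := by
  rcases Nat.eq_zero_or_pos x with rfl | hx1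
  · have h1 : ¬ IsMarked (row A) (-((0 : ℕ) : ℤ)) := by
      have := isMarked_natCast (row A) 0
      have := not_isRight_of_le (row A) (x := 0 + 1) (by omega)
      simp_all
    -- Only position `0` precedes `-1` in the sweep, so a marked `-1` must be joined to it.
    refine iff_of_false h1 fun ⟨h2, h3⟩ => h3 ?_
    have h4 := h.sweep_lt (by omega) (by omega) h2
    have h5 := h.apply_apply (p := -((0 : ℕ) : ℤ) - 1) (by omega) (by omega)
    have h6 : f (-((0 : ℕ) : ℤ) - 1) = (0 : ℕ) := by
      generalize f (-((0 : ℕ) : ℤ) - 1) = r at *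
      unfold sweep at h4
      split_ifs at h4 <;> omega
    rw [h6] at h5
    exact h5
  · have hc : -(x : ℤ) - 1 = -((x + 1 : ℕ) : ℤ) := by push_cast; ring
    rw [isMarked_neg _ hx1, ne_eq, h.apply_eq_neg_sub_one_iff hx, hc, isMarked_neg A (by omega),
      isLeft_row]
    have h1 : 1 ≤ x ∧ x + 1 ≤ n := by omega
    tauto

/-- A shift by one raises the sweep value of nonnegative positions by 2 and lowers that of negative
ones by 2, up to the wraparound and the passage from `-1` to `0`. As ends of an edge have opposite
parity, only edges joining `x` and `-x - 1` change order, as the marks of `row A` do. -/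
theorem IsMatching.rotate_row (h : IsMatching n (IsMarked A) f) {ρ ρ' : ℤ → ℤ} (hn : 0 < n)
    (hρ : ∀ p, ρ p = if p = (n : ℤ) - 1 then -(n : ℤ) else p + 1)
    (hρ' : ∀ p, ρ' p = if p = -(n : ℤ) then (n : ℤ) - 1 else p - 1) :
    IsMatching n (IsMarked (row A)) (fun p => ρ (f (ρ' p))) := by
  refine h.rotate hρ hρ' fun p h1 h2 => ?_
  have h3 := h.le_apply h1 h2
  have h4 := h.apply_lt h1 h2
  have h5 := h.odd_sub h1 h2
  have h6 := h.mk_iff h1 h2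
  have h7 := h.apply_apply h1 h2
  rw [Int.odd_iff] at h5
  by_cases hp : p = (n : ℤ) - 1
  · have e : ρ p = -(n : ℤ) := by rw [hρ, if_pos hp]
    rw [e, isMarked_neg _ (by omega), hρ (f p), if_neg (by omega)]
    refine iff_of_true (not_isLeft_of_le _ le_rfl) ?_
    unfold sweep
    split_ifs <;> omega
  · rw [hρ p, if_neg hp]
    by_cases hp0 : 0 ≤ p
    · obtain ⟨x, rfl⟩ := Int.eq_ofNat_of_zero_le hp0
      rw [h.isMarked_row_natCast_succ (by omega), h6, hρ]
      generalize f (x : ℤ) = r at *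
      unfold sweep
      split_ifs <;> omega
    · obtain ⟨x, rfl⟩ : ∃ x : ℕ, p = -(x : ℤ) - 1 := ⟨(-p - 1).toNat, by omega⟩
      have h8 : f x = -(x : ℤ) - 1 ↔ f (-(x : ℤ) - 1) = x := by
        constructor
        · intro e
          rw [← e, h.apply_apply (by omega) (by omega)]
        · intro e
          rw [← e, h7, e]
      rw [show -(x : ℤ) - 1 + 1 = -x by ring, h.isMarked_row_neg (by omega), h6, ne_eq, h8, hρ]
      generalize f (-(x : ℤ) - 1) = r at *
      unfold sweep
      split_ifs <;> omega

theorem IsMatching.reflect_Rvac (h : IsMatching n (IsMarked A) f) {σ : ℤ → ℤ}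
    (hσ : ∀ p, σ p = if p = -(n : ℤ) then -(n : ℤ) else -p) :
    IsMatching n (IsMarked (Rvac A)) (fun p => σ (f (σ p))) := by
  refine h.reflect hσ fun p h1 h2 => ?_
  rw [hσ]
  split_ifs with hp
  · rw [hp, isMarked_neg _ (by omega), isMarked_neg _ (by omega)]
    exact iff_of_true (not_isLeft_of_le _ le_rfl) (not_isLeft_of_le _ le_rfl)
  · rcases lt_trichotomy p 0 with h3 | rfl | h3
    · obtain ⟨x, rfl⟩ : ∃ x : ℕ, p = -(x : ℤ) := ⟨(-p).toNat, by omega⟩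
      rw [neg_neg, isMarked_neg _ (by omega), isMarked_natCast, isLeft_Rvac]
      have : 1 ≤ x ∧ x + 1 ≤ n := by omega
      tauto
    · rw [neg_zero]
      have e1 := isMarked_natCast A 0
      have e2 := isMarked_natCast (Rvac A) 0
      have e3 := not_isRight_of_le A (x := 0 + 1) (by omega)
      have e4 := not_isRight_of_le (Rvac A) (x := 0 + 1) (by omega)
      simp_all
    · obtain ⟨x, rfl⟩ : ∃ x : ℕ, p = (x : ℤ) := ⟨p.toNat, by omega⟩
      rw [isMarked_neg _ (by omega), isMarked_natCast, isRight_Rvac]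
      have : 1 ≤ x ∧ x + 1 ≤ n := by omega
      tauto

end Marks
-- Existence of a matching, built along the sweep.
section Existence

/-- `f` is a noncrossing partial matching (`f p = p` says that `p` is free) with no free position
below an edge. -/
structure IsNested (f : ℤ → ℤ) : Prop where
  apply_apply : ∀ p, f (f p) = p
  nest : ∀ {p q}, p < q → q < f p → (p < f q ∧ f q < f p) ∧ f q ≠ q

/-- Join the positions `w` and `p`. -/
def join (f : ℤ → ℤ) (w p : ℤ) : ℤ → ℤ := fun q => if q = w then p else if q = p then w else f q

theorem join_comm (f : ℤ → ℤ) (w p : ℤ) : join f w p = join f p w := by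
  funext q
  unfold join
  split_ifs <;> simp_all

/-- An edge leaving the stretch between `w` and `p` would pass over one of these free positions,
which nestedness forbids. -/
theorem IsNested.join {f : ℤ → ℤ} (h : IsNested f) {w p : ℤ} (hw : f w = w) (hp : f p = p)
    (hwp : w < p) (hb : ∀ q, w < q → q < p → f q ≠ q) : IsNested (join f w p) := by
  have hfw : ∀ {q}, f q = w → q = w := fun {q} e => by rw [← h.apply_apply q, e, hw]
  have hfp : ∀ {q}, f q = p → q = p := fun {q} e => by rw [← h.apply_apply q, e, hp]
  refine ⟨fun q => ?_, ?_⟩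
  · unfold RowvacA.join
    have h1 := h.apply_apply q
    by_cases hqw : q = w
    · subst hqw
      rw [if_pos rfl, if_neg hwp.ne', if_pos rfl]
    · by_cases hqp : q = p
      · subst hqp
        rw [if_neg hwp.ne', if_pos rfl, if_pos rfl]
      · rw [if_neg hqw, if_neg hqp, if_neg (fun e => hqw (hfw e)), if_neg (fun e => hqp (hfp e)), h1]
  · intro r q hrq hq
    by_cases hr : r = w
    · have e : RowvacA.join f w p r = p := by simp [RowvacA.join, hr]
      rw [e] at hq ⊢
      have e' : RowvacA.join f w p q = f q := by
        unfold RowvacA.join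
        rw [if_neg (by omega), if_neg (by omega)]
      rw [e']
      have h1 : f q ≠ w := fun e => by have := hfw e; omega
      have h2 : f q ≠ p := fun e => by have := hfp e; omega
      have h3 : ¬ f q < w := fun hlt => by
        refine (h.nest hlt ?_).2 hw
        rw [h.apply_apply]
        omega
      have h4 : ¬ p < f q := fun hlt => (h.nest hq hlt).2 hp
      exact ⟨by omega, hb q (by omega) hq⟩
    · by_cases hr' : r = p
      · have e : RowvacA.join f w p r = w := by
          unfold RowvacA.join
          rw [if_neg hr, if_pos hr']
        omega
      · have e : RowvacA.join f w p r = f r := by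
          unfold RowvacA.join
          rw [if_neg hr, if_neg hr']
        rw [e] at hq ⊢
        have h1 := h.nest hrq hq
        have h2 : q ≠ w := fun e => h1.2 (by rw [e, hw])
        have h3 : q ≠ p := fun e => h1.2 (by rw [e, hp])
        have e' : RowvacA.join f w p q = f q := by
          unfold RowvacA.join
          rw [if_neg h2, if_neg h3]
        rw [e']
        exact h1

/-- The state of the sweep when the positions in `[a, b)` have been met. -/
structure IsSweep (mk : ℤ → Prop) (a b : ℤ) (f : ℤ → ℤ) : Prop where
  nested : IsNested f
  mapsTo : ∀ {p}, a ≤ p → p < b → a ≤ f p ∧ f p < b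
  apply_of_not : ∀ {p}, ¬ (a ≤ p ∧ p < b) → f p = p
  sweep_lt : ∀ {p}, a ≤ p → p < b → mk p → sweep (f p) < sweep p
  sweep_le : ∀ {p}, a ≤ p → p < b → ¬ mk p → sweep p ≤ sweep (f p)

open Classical in
/-- As long as fewer than half of the positions are marked, there is a free position. -/
theorem IsSweep.exists_free {mk : ℤ → Prop} {a b : ℤ} {f : ℤ → ℤ} (h : IsSweep mk a b f)
    (hc : 2 * ((Finset.Ico a b).filter mk).card ≠ (b - a).toNat) :
    ∃ w, (a ≤ w ∧ w < b) ∧ f w = w := by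
  by_contra hno
  push Not at hno
  apply hc
  have hmk : ∀ {p}, a ≤ p → p < b → (mk (f p) ↔ ¬ mk p) := by
    intro p h1 h2
    obtain ⟨h3, h4⟩ := h.mapsTo h1 h2
    have hne := hno p ⟨h1, h2⟩
    have haa := h.nested.apply_apply p
    constructor
    · intro h5 h6
      have h7 := h.sweep_lt h1 h2 h6
      have h8 := h.sweep_lt h3 h4 h5
      rw [haa] at h8
      omega
    · intro h5
      by_contra h6
      have h7 := h.sweep_le h1 h2 h5
      have h8 := h.sweep_le h3 h4 h6
      rw [haa] at h8
      generalize f p = r at *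
      unfold sweep at *
      split_ifs at * <;> omega
  have h1 : ((Finset.Ico a b).filter mk).card = ((Finset.Ico a b).filter fun p => ¬ mk p).card := by
    refine Finset.card_bij' (fun p _ => f p) (fun p _ => f p) ?_ ?_ ?_ ?_
    all_goals
      intro p hp
      simp only [Finset.mem_filter, Finset.mem_Ico] at hp ⊢
    · exact ⟨h.mapsTo hp.1.1 hp.1.2, by
        rw [hmk hp.1.1 hp.1.2]; exact not_not.mpr hp.2⟩
    · exact ⟨h.mapsTo hp.1.1 hp.1.2, by
        rw [hmk hp.1.1 hp.1.2]; exact hp.2⟩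
    · exact h.nested.apply_apply p
    · exact h.nested.apply_apply p
  have h2 := Finset.card_filter_add_card_filter_not (s := Finset.Ico a b) mk
  rw [Int.card_Ico] at h2
  omega

/-- A marked new position is joined to the nearest free one. The new position is adjacent to the
interval, so everything in between is already matched and `IsNested.join` applies. -/
theorem IsSweep.extend {mk : ℤ → Prop} {a b a' b' p : ℤ} {f : ℤ → ℤ} (h : IsSweep mk a b f)
    (hab : a ≤ b) (hp : (p = b ∧ a' = a ∧ b' = b + 1) ∨ (p = a - 1 ∧ a' = a - 1 ∧ b' = b))
    (hs : ∀ q, a ≤ q → q < b → sweep q < sweep p)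
    (hfree : mk p → ∃ w, (a ≤ w ∧ w < b) ∧ f w = w) : ∃ f', IsSweep mk a' b' f' := by
  classical
  have hfp : f p = p := h.apply_of_not (by omega)
  have hsplit : ∀ {q}, a' ≤ q → q < b' → q ≠ p → a ≤ q ∧ q < b := by
    intro q h1 h2 h3
    omega
  by_cases hm : mk p
  · obtain ⟨w₀, hw₀, hfw₀⟩ := hfree hm
    obtain ⟨w, hw, hmin⟩ := Finset.exists_min_image
      ((Finset.Ico a b).filter fun w => f w = w) (fun w => (w - p).natAbs)
      ⟨w₀, by simp [hw₀, hfw₀]⟩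
    simp only [Finset.mem_filter, Finset.mem_Ico] at hw hmin
    obtain ⟨hwr, hfw⟩ := hw
    have hnest : IsNested (join f w p) := by
      rcases lt_or_gt_of_ne (show w ≠ p by omega) with hlt | hlt
      · refine h.nested.join hfw hfp hlt fun q h1 h2 h3 => ?_
        have := hmin q ⟨by omega, h3⟩
        omega
      · rw [join_comm]
        refine h.nested.join hfp hfw hlt fun q h1 h2 h3 => ?_
        have := hmin q ⟨by omega, h3⟩
        omega
    have ew : join f w p w = p := by simp [join]
    have ep : join f w p p = w := by
      unfold join; split_ifs <;> omega
    have eq : ∀ {q}, q ≠ w → q ≠ p → join f w p q = f q := fun h1 h2 => by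
      unfold join; rw [if_neg h1, if_neg h2]
    have hsw := hs w hwr.1 hwr.2
    have hmw : ¬ mk w := fun hmw => by
      have := h.sweep_lt hwr.1 hwr.2 hmw
      rw [hfw] at this
      omega
    refine ⟨join f w p, hnest, fun {q} h1 h2 => ?_, fun {q} h1 => ?_, fun {q} h1 h2 h3 => ?_,
      fun {q} h1 h2 h3 => ?_⟩
    all_goals
      by_cases hqw : q = w
      · subst hqw
        first
          | (rw [ew]; omega)
          | (exact absurd h3 hmw)
      by_cases hqp : q = p
      · subst hqp
        first
          | (rw [ep]; omega)
          | (exact absurd hm h3)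
      rw [eq hqw hqp]
    · obtain ⟨h3, h4⟩ := hsplit h1 h2 hqp
      have := h.mapsTo h3 h4
      omega
    · exact h.apply_of_not (by omega)
    · obtain ⟨h4, h5⟩ := hsplit h1 h2 hqp
      exact h.sweep_lt h4 h5 h3
    · obtain ⟨h4, h5⟩ := hsplit h1 h2 hqp
      exact h.sweep_le h4 h5 h3
  · refine ⟨f, h.nested, fun {q} h1 h2 => ?_, fun {q} h1 => h.apply_of_not (by omega),
      fun {q} h1 h2 h3 => ?_, fun {q} h1 h2 h3 => ?_⟩
    · by_cases hqp : q = p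
      · subst hqp
        omega
      · obtain ⟨h3, h4⟩ := hsplit h1 h2 hqp
        have := h.mapsTo h3 h4
        omega
    · have hqp : q ≠ p := fun e => hm (e ▸ h3)
      obtain ⟨h4, h5⟩ := hsplit h1 h2 hqp
      exact h.sweep_lt h4 h5 h3
    · by_cases hqp : q = p
      · rw [hqp, hfp]
      · obtain ⟨h4, h5⟩ := hsplit h1 h2 hqp
        exact h.sweep_le h4 h5 h3

variable {n : ℕ}

theorem exists_isSweep (A : Antichains (RootA n)) (k : ℕ) :
    ∃ f, IsSweep (IsMarked A) (-(k : ℤ)) k f := by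
  classical
  induction k with
  | zero =>
    refine ⟨id, ⟨fun _ => rfl, fun h1 h2 => ?_⟩, fun h1 h2 => ?_, fun _ => rfl, fun h1 h2 => ?_,
      fun h1 h2 => ?_⟩
    · simp only [id] at h2
      omega
    all_goals omega
  | succ k ih =>
    obtain ⟨f, hf⟩ := ih
    obtain ⟨g, hg⟩ := hf.extend (p := k) (a' := -(k : ℤ)) (b' := k + 1) (by omega)
      (Or.inl ⟨rfl, rfl, rfl⟩)
      (fun q h1 h2 => by unfold sweep; split_ifs <;> omega)
      -- If `[-k, k)` were balanced, `A` would split at `k`, but the marking at `k` comes from an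
      -- interval ending at `k + 1`.
      (fun hm => hf.exists_free fun hc => by
        have hs := (card_isMarked_eq_iff A k).mp (by omega)
        obtain ⟨a, ha, hak⟩ := (isMarked_natCast A k).mp hm
        have := hs a ha
        have := a.lt
        omega)
    obtain ⟨g₂, hg₂⟩ := hg.extend (p := -(k : ℤ) - 1) (a' := -((k + 1 : ℕ) : ℤ))
      (b' := ((k + 1 : ℕ) : ℤ)) (by omega)
      (Or.inr ⟨rfl, by push_cast; ring, by push_cast; ring⟩)
      (fun q h1 h2 => by unfold sweep; split_ifs <;> omega)
      -- The swept interval now has odd length `2 * k + 1`, so it cannot be perfectly matched.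
      (fun _ => hg.exists_free (by omega))
    exact ⟨g₂, hg₂⟩

/-- Every antichain has a matching. -/
theorem exists_isMatching (A : Antichains (RootA n)) : ∃ f, IsMatching n (IsMarked A) f := by
  classical
  obtain ⟨f, h⟩ := exists_isSweep A n
  have haa := h.nested.apply_apply
  -- No interval contains `[n, n + 1]`, so exactly half of all positions are marked; by counting,
  -- every unmarked one is a partner and nothing stays free.
  have hcard : ((Finset.Ico (-(n : ℤ)) n).filter (IsMarked A)).card = n := by
    rw [card_isMarked_eq_iff]
    intro a _ ha
    have := a.le_n
    omega
  have hneg := Finset.card_filter_add_card_filter_not (s := Finset.Ico (-(n : ℤ)) n) (IsMarked A)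
  rw [Int.card_Ico] at hneg
  refine ⟨f, fun h1 h2 => (h.mapsTo h1 h2).1, fun h1 h2 => (h.mapsTo h1 h2).2, fun _ _ => haa _,
    fun _ h1 h2 _ => (h.nested.nest h1 h2).1, h.sweep_lt, fun {p} h1 h2 h3 => ?_⟩
  obtain ⟨q, hq, hqp⟩ := Finset.surj_on_of_inj_on_of_card_le
    (s := (Finset.Ico (-(n : ℤ)) n).filter (IsMarked A))
    (t := (Finset.Ico (-(n : ℤ)) n).filter fun p => ¬ IsMarked A p) (fun q _ => f q)
    (fun q hq => by
      simp only [Finset.mem_filter, Finset.mem_Ico] at hq ⊢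
      have hm := h.mapsTo hq.1.1 hq.1.2
      refine ⟨hm, fun h5 => ?_⟩
      have h6 := h.sweep_lt hq.1.1 hq.1.2 hq.2
      have h7 := h.sweep_lt hm.1 hm.2 h5
      rw [haa] at h7
      omega)
    (fun q r _ _ e => by rw [← haa q, e, haa])
    (by omega) p (by simp [h1, h2, h3])
  simp only [Finset.mem_filter, Finset.mem_Ico] at hq
  rw [hqp, haa]
  exact h.sweep_lt hq.1.1 hq.1.2 hq.2

end Existence

/-! ### The greedy drawing rule produces the edges of any matching. -/

section Greedy

variable {n : ℕ}

open Classical in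
/-- The position of the marking `i`. -/
noncomputable def markPos (A : Antichains (RootA n)) (i : ℕ) : ℤ :=
  if h : ∃ a ∈ A.1, a.lo = i then (h.choose.hi : ℤ) - 1 else -(i : ℤ)

theorem markPos_lo {A : Antichains (RootA n)} {a : RootA n} (ha : a ∈ A.1) :
    markPos A a.lo = (a.hi : ℤ) - 1 := by
  have h : ∃ b ∈ A.1, b.lo = a.lo := ⟨a, ha, rfl⟩
  unfold markPos
  rw [dif_pos h, eq_of_lo_eq h.choose_spec.1 ha h.choose_spec.2]

theorem markPos_of_not_isLeft {A : Antichains (RootA n)} {i : ℕ} (h : ¬ IsLeft A i) :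
    markPos A i = -(i : ℤ) := by
  unfold markPos
  unfold IsLeft at h
  rw [dif_neg h]

theorem marker_lo {A : Antichains (RootA n)} {a : RootA n} (ha : a ∈ A.1) :
    marker A a.lo = ((markPos A a.lo : ZMod (2 * n)), -1) := by
  have h : ∃ b ∈ A.1, b.lo = a.lo := ⟨a, ha, rfl⟩
  unfold marker
  rw [dif_pos h, markPos_lo ha, eq_of_lo_eq h.choose_spec.1 ha h.choose_spec.2]
  simp [psiPlace]

theorem marker_of_not_isLeft {A : Antichains (RootA n)} {i : ℕ} (h : ¬ IsLeft A i) :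
    marker A i = ((markPos A i : ZMod (2 * n)), 1) := by
  unfold marker
  rw [markPos_of_not_isLeft h]
  unfold IsLeft at h
  rw [dif_neg h]
  simp [psiPlace]

theorem marker_fst (A : Antichains (RootA n)) (i : ℕ) :
    (marker A i).1 = (markPos A i : ZMod (2 * n)) := by
  by_cases h : IsLeft A i
  · obtain ⟨a, ha, rfl⟩ := h
    rw [marker_lo ha]
  · rw [marker_of_not_isLeft h]

theorem markPos_mem (A : Antichains (RootA n)) {i : ℕ} (h1 : 1 ≤ i) (h2 : i ≤ n) :
    (-(n : ℤ) ≤ markPos A i ∧ markPos A i < n) ∧ IsMarked A (markPos A i) := by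
  by_cases h : IsLeft A i
  · obtain ⟨a, ha, rfl⟩ := h
    have := a.lt
    have := a.le_n
    rw [markPos_lo ha]
    refine ⟨by omega, ?_⟩
    rw [show (a.hi : ℤ) - 1 = ((a.hi - 1 : ℕ) : ℤ) by omega, isMarked_natCast]
    exact ⟨a, ha, by omega⟩
  · rw [markPos_of_not_isLeft h]
    exact ⟨by omega, (isMarked_neg A h1).mpr h⟩

theorem exists_markPos_eq (A : Antichains (RootA n)) {p : ℤ} (h1 : -(n : ℤ) ≤ p)
    (hm : IsMarked A p) : ∃ i, (1 ≤ i ∧ i ≤ n) ∧ markPos A i = p := by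
  by_cases hp : 0 ≤ p
  · obtain ⟨x, rfl⟩ := Int.eq_ofNat_of_zero_le hp
    obtain ⟨a, ha, hax⟩ := (isMarked_natCast A x).mp hm
    have := a.one_le
    have := a.lt
    have := a.le_n
    exact ⟨a.lo, by omega, by rw [markPos_lo ha]; omega⟩
  · obtain ⟨x, rfl⟩ : ∃ x : ℕ, p = -(x : ℤ) := ⟨(-p).toNat, by omega⟩
    exact ⟨x, by omega, markPos_of_not_isLeft ((isMarked_neg A (by omega)).mp hm)⟩

theorem intCast_inj {p q : ℤ} (hp : -(n : ℤ) ≤ p ∧ p < n) (hq : -(n : ℤ) ≤ q ∧ q < n) :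
    (p : ZMod (2 * n)) = q ↔ p = q := by
  refine ⟨fun h => ?_, fun h => by rw [h]⟩
  rw [ZMod.intCast_eq_intCast_iff_dvd_sub] at h
  obtain ⟨c, hc⟩ := h
  push_cast at hc
  have h1 : c < 1 := by
    by_contra hlt
    nlinarith
  have h2 : -1 < c := by
    by_contra hlt
    nlinarith
  obtain rfl : c = 0 := by omega
  omega

variable {A : Antichains (RootA n)} {f : ℤ → ℤ}

/-- The markings met strictly between a marking and its partner come earlier. -/
theorem IsMatching.lt_of_between (h : IsMatching n (IsMarked A) f) {i j : ℕ} (hi : 1 ≤ i)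
    (hin : i ≤ n) (hj : 1 ≤ j) (hjn : j ≤ n)
    (hb : (f (markPos A i) < markPos A j ∧ markPos A j < markPos A i) ∨
      (markPos A i < markPos A j ∧ markPos A j < f (markPos A i))) : j < i := by
  classical
  obtain ⟨⟨hr1, hr2⟩, hm⟩ := markPos_mem A hi hin
  have hsw := h.sweep_lt hr1 hr2 hm
  have hfr1 := h.le_apply hr1 hr2
  by_cases hl : IsLeft A i
  · obtain ⟨a, ha, rfl⟩ := hl
    have ha1 := a.lt
    have ep := markPos_lo ha
    rw [ep] at hb hsw hr1 hr2 hfr1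
    have hlt : f ((a.hi : ℤ) - 1) < (a.hi : ℤ) - 1 := by
      generalize f ((a.hi : ℤ) - 1) = r at *
      unfold sweep at hsw
      split_ifs at hsw <;> omega
    by_cases hjl : IsLeft A j
    · obtain ⟨b, hb', rfl⟩ := hjl
      rw [markPos_lo hb'] at hb
      rw [lo_lt_lo_iff hb' ha]
      omega
    · rw [markPos_of_not_isLeft hjl] at hb
      -- If `a.lo < j`, let the edge run from `a.hi - 1` to `-(u + 1)`, so `a.lo < j ≤ u`. Right
      -- ends below `a.hi` then have left ends at most `u`, so at most `u` positions inside the edge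
      -- are marked. But half of the `u + a.hi - 1` positions inside are marked, which is more than
      -- `u` because the marked end comes later in the sweep.
      by_contra hji
      have hji' : a.lo ≠ j := fun e => hjl ⟨a, ha, e⟩
      obtain ⟨u, hu⟩ : ∃ u : ℕ, f ((a.hi : ℤ) - 1) = -((u + 1 : ℕ) : ℤ) :=
        ⟨(-f ((a.hi : ℤ) - 1) - 1).toNat, by omega⟩
      have hc := h.two_mul_card_Ico (p := f ((a.hi : ℤ) - 1)) hfr1 (by omega)
      rw [h.apply_apply hr1 hr2, hu, show -((u + 1 : ℕ) : ℤ) + 1 = -(u : ℤ) by push_cast; ring,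
        show (a.hi : ℤ) - 1 = ((a.hi - 1 : ℕ) : ℤ) by omega] at hc
      have hcm := card_isMarked A u (a.hi - 1)
      have hle : numRight A (a.hi - 1) ≤ numLeft A u := by
        refine Finset.card_le_card fun b hb' => ?_
        simp only [Finset.mem_filter] at hb' ⊢
        have := (lo_lt_lo_iff hb'.1 ha).mpr (by omega)
        exact ⟨hb'.1, by omega⟩
      rw [hu] at hsw
      unfold sweep at hsw
      split_ifs at hsw <;> omega
  · have ep := markPos_of_not_isLeft hl
    rw [ep] at hb hsw hr1 hr2 hfr1
    have hlt : -(i : ℤ) < f (-(i : ℤ)) ∧ f (-(i : ℤ)) < i := by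
      generalize f (-(i : ℤ)) = r at *
      unfold sweep at hsw
      split_ifs at hsw <;> omega
    by_cases hjl : IsLeft A j
    · obtain ⟨b, hb', rfl⟩ := hjl
      rw [markPos_lo hb'] at hb
      have := b.lt
      omega
    · rw [markPos_of_not_isLeft hjl] at hb
      omega

/-- The edges of the matching at the first `k` markings. -/
def edgesOf (A : Antichains (RootA n)) (f : ℤ → ℤ) (k : ℕ) : Set (Sym2 (ZMod (2 * n))) :=
  {e | ∃ i, (1 ≤ i ∧ i ≤ k) ∧
    e = s((markPos A i : ZMod (2 * n)), (f (markPos A i) : ZMod (2 * n)))}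

theorem IsMatching.available_iff (h : IsMatching n (IsMarked A) f) {k : ℕ} (hk : k ≤ n) {p : ℤ}
    (h1 : -(n : ℤ) ≤ p) (h2 : p < n) :
    Available A (edgesOf A f k) (p : ZMod (2 * n)) ↔
      ¬ IsMarked A p ∧ ∀ i, 1 ≤ i → i ≤ k → markPos A i ≠ f p := by
  have hf1 := h.le_apply h1 h2
  have hf2 := h.apply_lt h1 h2
  constructor
  · rintro ⟨g1, g2⟩
    constructor
    · intro hm
      obtain ⟨i, hi, rfl⟩ := exists_markPos_eq A h1 hm
      exact g1 i (Finset.mem_Icc.mpr hi) (marker_fst A i)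
    · intro i hi hik e
      refine g2 _ ⟨i, ⟨hi, hik⟩, rfl⟩ ?_
      rw [e, h.apply_apply h1 h2]
      exact Sym2.mem_mk_right _ _
  · rintro ⟨g1, g2⟩
    constructor
    · intro i hi e
      rw [Finset.mem_Icc] at hi
      obtain ⟨hr, hm⟩ := markPos_mem A hi.1 hi.2
      rw [marker_fst, intCast_inj hr ⟨h1, h2⟩] at e
      exact g1 (e ▸ hm)
    · rintro e ⟨i, ⟨hi, hik⟩, rfl⟩ hmem
      obtain ⟨hr, hm⟩ := markPos_mem A hi (hik.trans hk)
      rw [Sym2.mem_iff, intCast_inj ⟨h1, h2⟩ hr,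
        intCast_inj ⟨h1, h2⟩ ⟨h.le_apply hr.1 hr.2, h.apply_lt hr.1 hr.2⟩] at hmem
      rcases hmem with e | e
      · exact g1 (e ▸ hm)
      · exact g2 i hi hik (by rw [e, h.apply_apply hr.1 hr.2])

/-- An unmarked position under the edge has its partner under the same edge. That partner is an
earlier marking by `IsMatching.lt_of_between`, so its edge is already drawn. -/
theorem IsMatching.between_matched (h : IsMatching n (IsMarked A) f) {k : ℕ} (hk : k + 1 ≤ n)
    {q : ℤ} (hb : (f (markPos A (k + 1)) < q ∧ q < markPos A (k + 1)) ∨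
      (markPos A (k + 1) < q ∧ q < f (markPos A (k + 1)))) :
    ¬ Available A (edgesOf A f k) (q : ZMod (2 * n)) := by
  obtain ⟨⟨hr1, hr2⟩, hm⟩ := markPos_mem A (Nat.le_add_left 1 k) hk
  have hf1 := h.le_apply hr1 hr2
  have hf2 := h.apply_lt hr1 hr2
  have haa := h.apply_apply hr1 hr2
  have hb' : (f (markPos A (k + 1)) < f q ∧ f q < markPos A (k + 1)) ∨
      (markPos A (k + 1) < f q ∧ f q < f (markPos A (k + 1))) := by
    rcases hb with hb | hb
    · have := h.nest hf1 hb.1 (by rw [haa]; exact hb.2) hf2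
      rw [haa] at this
      exact Or.inl this
    · exact Or.inr (h.nest hr1 hb.1 hb.2 hr2)
  rw [h.available_iff (by omega) (by omega) (by omega)]
  rintro ⟨g1, g2⟩
  have hmq := (h.mk_apply (p := q) (by omega) (by omega)).mpr g1
  obtain ⟨i, hi, e⟩ := exists_markPos_eq A (by omega) hmq
  rw [← e] at hb'
  have := h.lt_of_between (Nat.le_add_left 1 k) hk hi.1 hi.2 hb'
  exact g2 i hi.1 (by omega) e

theorem IsMatching.available_apply (h : IsMatching n (IsMarked A) f) {k : ℕ} (hk : k + 1 ≤ n) :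
    Available A (edgesOf A f k) (f (markPos A (k + 1)) : ZMod (2 * n)) := by
  obtain ⟨⟨hr1, hr2⟩, hm⟩ := markPos_mem A (Nat.le_add_left 1 k) hk
  rw [h.available_iff (by omega) (h.le_apply hr1 hr2) (h.apply_lt hr1 hr2), h.mk_apply hr1 hr2,
    h.apply_apply hr1 hr2]
  refine ⟨not_not.mpr hm, fun i hi hik e => ?_⟩
  -- What remains is that distinct markings sit at distinct positions.
  by_cases hl : IsLeft A (k + 1)
  · obtain ⟨a, ha, hak⟩ := hl
    have ha1 := a.lt
    rw [← hak, markPos_lo ha] at e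
    by_cases hl' : IsLeft A i
    · obtain ⟨b, hb, rfl⟩ := hl'
      rw [markPos_lo hb] at e
      have := lo_lt_lo_iff hb ha
      omega
    · rw [markPos_of_not_isLeft hl'] at e
      omega
  · rw [markPos_of_not_isLeft hl] at e
    by_cases hl' : IsLeft A i
    · obtain ⟨b, hb, rfl⟩ := hl'
      have := b.lt
      rw [markPos_lo hb] at e
      omega
    · rw [markPos_of_not_isLeft hl'] at e
      omega

theorem sInf_eq_of_forall_lt {s : Set ℕ} {d : ℕ} (hd : d ∈ s) (h : ∀ e, e < d → e ∉ s) :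
    sInf s = d :=
  le_antisymm (Nat.sInf_le hd) (le_csInf ⟨d, hd⟩ fun e he => not_lt.mp fun hlt => h e hlt he)

theorem IsMatching.partner_eq (h : IsMatching n (IsMarked A) f) {k : ℕ} (hk : k + 1 ≤ n) :
    partner A (edgesOf A f k) (k + 1) = (f (markPos A (k + 1)) : ZMod (2 * n)) := by
  obtain ⟨⟨hr1, hr2⟩, hm⟩ := markPos_mem A (Nat.le_add_left 1 k) hk
  have hsw := h.sweep_lt hr1 hr2 hm
  have hav := h.available_apply hk
  have hnav := fun {q : ℤ} => h.between_matched (q := q) hk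
  have hnm : ¬ Available A (edgesOf A f k) (markPos A (k + 1) : ZMod (2 * n)) := by
    rw [h.available_iff (by omega) hr1 hr2]
    exact fun g => g.1 hm
  unfold partner
  by_cases hl : IsLeft A (k + 1)
  · obtain ⟨a, ha, hak⟩ := hl
    have ha1 := a.lt
    have hp : markPos A (k + 1) = (a.hi : ℤ) - 1 := by rw [← hak, markPos_lo ha]
    have hlt : f (markPos A (k + 1)) < markPos A (k + 1) := by
      generalize f (markPos A (k + 1)) = r at *
      unfold sweep at hsw
      split_ifs at hsw <;> omega
    rw [← hak, marker_lo ha, hak]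
    have hcast : ∀ d : ℕ, (markPos A (k + 1) : ZMod (2 * n)) + d * -1 =
        ((markPos A (k + 1) - d : ℤ) : ZMod (2 * n)) := fun d => by push_cast; ring
    simp only [hcast]
    have hd : (((markPos A (k + 1) - f (markPos A (k + 1))).toNat : ℕ) : ℤ) =
        markPos A (k + 1) - f (markPos A (k + 1)) := Int.toNat_of_nonneg (by omega)
    rw [sInf_eq_of_forall_lt (d := (markPos A (k + 1) - f (markPos A (k + 1))).toNat)]
    · rw [hd]; congr 1; ring
    · rw [Set.mem_ofPred_eq, hd, sub_sub_cancel]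
      exact hav
    · intro e he
      rw [Set.mem_ofPred_eq]
      rcases Nat.eq_zero_or_pos e with rfl | he0
      · simpa using hnm
      · exact hnav (Or.inl (by omega))
  · have hp := markPos_of_not_isLeft hl
    have hlt : markPos A (k + 1) < f (markPos A (k + 1)) := by
      generalize f (markPos A (k + 1)) = r at *
      unfold sweep at hsw
      split_ifs at hsw <;> omega
    rw [marker_of_not_isLeft hl]
    have hcast : ∀ d : ℕ, (markPos A (k + 1) : ZMod (2 * n)) + d * 1 =
        ((markPos A (k + 1) + d : ℤ) : ZMod (2 * n)) := fun d => by push_cast; ring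
    simp only [hcast]
    have hd : (((f (markPos A (k + 1)) - markPos A (k + 1)).toNat : ℕ) : ℤ) =
        f (markPos A (k + 1)) - markPos A (k + 1) := Int.toNat_of_nonneg (by omega)
    rw [sInf_eq_of_forall_lt (d := (f (markPos A (k + 1)) - markPos A (k + 1)).toNat)]
    · rw [hd]; congr 1; ring
    · rw [Set.mem_ofPred_eq, hd, add_sub_cancel]
      exact hav
    · intro e he
      rw [Set.mem_ofPred_eq]
      rcases Nat.eq_zero_or_pos e with rfl | he0
      · simpa using hnm
      · exact hnav (Or.inr (by omega))

theorem IsMatching.edgesUpTo_eq (h : IsMatching n (IsMarked A) f) {k : ℕ} (hk : k ≤ n) :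
    edgesUpTo A k = edgesOf A f k := by
  induction k with
  | zero =>
    refine Eq.symm (Set.eq_empty_iff_forall_notMem.mpr ?_)
    rintro e ⟨i, hi, -⟩
    omega
  | succ k ih =>
    rw [edgesUpTo, ih (by omega), h.partner_eq hk, marker_fst]
    ext e
    constructor
    · rintro (rfl | ⟨i, hi, rfl⟩)
      · exact ⟨k + 1, by omega, rfl⟩
      · exact ⟨i, by omega, rfl⟩
    · rintro ⟨i, hi, rfl⟩
      by_cases e : i = k + 1
      · subst e
        exact Set.mem_insert _ _
      · exact Set.mem_insert_of_mem _ ⟨i, by omega, rfl⟩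

/-- The edges of the diagram of `A` are those of any matching of `A`. -/
theorem IsMatching.mem_edgesUpTo (h : IsMatching n (IsMarked A) f) (u v : ZMod (2 * n)) :
    s(u, v) ∈ edgesUpTo A n ↔
      ∃ p : ℤ, (-(n : ℤ) ≤ p ∧ p < n) ∧ u = (p : ZMod (2 * n)) ∧ v = (f p : ZMod (2 * n)) := by
  rw [h.edgesUpTo_eq le_rfl]
  constructor
  · rintro ⟨i, hi, e⟩
    obtain ⟨hr, -⟩ := markPos_mem A hi.1 hi.2
    rcases Sym2.eq_iff.mp e with ⟨e1, e2⟩ | ⟨e1, e2⟩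
    · exact ⟨_, hr, e1, e2⟩
    · exact ⟨_, ⟨h.le_apply hr.1 hr.2, h.apply_lt hr.1 hr.2⟩, e1, by
        rw [e2, h.apply_apply hr.1 hr.2]⟩
  · rintro ⟨p, hr, rfl, rfl⟩
    by_cases hm : IsMarked A p
    · obtain ⟨i, hi, rfl⟩ := exists_markPos_eq A hr.1 hm
      exact ⟨i, hi, rfl⟩
    · obtain ⟨i, hi, e⟩ := exists_markPos_eq A (h.le_apply hr.1 hr.2)
        ((h.mk_apply hr.1 hr.2).mpr hm)
      exact ⟨i, hi, by rw [e, h.apply_apply hr.1 hr.2]; exact Sym2.eq_swap⟩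

end Greedy
-- The reflection through `M` on the places of the circle.
section Geometry

/-- In the coordinate `z ↦ c + w * z` the bisector of two conjugate points is the real axis, so
reflecting in it is complex conjugation. -/
theorem reflection_perpBisector_apply (c w : ℂ) (x y x₀ y₀ : ℝ) (hy₀ : y₀ ≠ 0)
    [Nonempty (AffineSubspace.perpBisector (c + w * (x₀ + y₀ * Complex.I))
      (c + w * (x₀ - y₀ * Complex.I)))] :
    EuclideanGeometry.reflection (AffineSubspace.perpBisector (c + w * (x₀ + y₀ * Complex.I))
      (c + w * (x₀ - y₀ * Complex.I))) (c + w * (x + y * Complex.I)) =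
      c + w * (x - y * Complex.I) := by
  have h1 : c + w * x ∈ AffineSubspace.perpBisector (c + w * (x₀ + y₀ * Complex.I))
      (c + w * (x₀ - y₀ * Complex.I)) := by
    have e1 : c + w * x - (c + w * x₀) = ((x - x₀ : ℝ) : ℂ) * w := by push_cast; ring
    have e2 : c + w * (x₀ - y₀ * Complex.I) - (c + w * (x₀ + y₀ * Complex.I)) =
        ((-2 * y₀ : ℝ) : ℂ) * (w * Complex.I) := by push_cast; ring
    have e3 : midpoint ℝ (c + w * (x₀ + y₀ * Complex.I)) (c + w * (x₀ - y₀ * Complex.I)) =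
        c + w * x₀ := by
      rw [midpoint_eq_smul_add, Complex.real_smul]
      rw [invOf_eq_inv]
      push_cast
      ring
    rw [AffineSubspace.mem_perpBisector_iff_inner_eq_zero, e3, vsub_eq_sub, vsub_eq_sub, e1, e2,
      ← Complex.real_smul, ← Complex.real_smul, real_inner_smul_left, real_inner_smul_right,
      Complex.inner]
    simp
    right
    right
    ring
  have h2 : w * (y * Complex.I) ∈ (AffineSubspace.perpBisector (c + w * (x₀ + y₀ * Complex.I))
      (c + w * (x₀ - y₀ * Complex.I))).directionᗮ := by
    rw [AffineSubspace.direction_perpBisector, Submodule.orthogonal_orthogonal,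
      Submodule.mem_span_singleton]
    refine ⟨-y / (2 * y₀), ?_⟩
    rw [vsub_eq_sub, Complex.real_smul]
    have : (y₀ : ℂ) ≠ 0 := by exact_mod_cast hy₀
    push_cast
    field_simp
    ring
  have h3 := EuclideanGeometry.reflection_orthogonal_vadd h1 h2
  rw [vadd_eq_add, vadd_eq_add] at h3
  rw [show c + w * (x + y * Complex.I) = w * (y * Complex.I) + (c + w * x) by ring, h3]
  ring

variable {n : ℕ}

theorem Frame.point_intCast (F : Frame) (hn : 0 < n) (m : ℤ) :
    F.point (m : ZMod (2 * n)) = F.center + F.radius *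
      Complex.exp (((F.angle - Real.pi * m / n : ℝ) : ℂ) * Complex.I) := by
  have : NeZero (2 * n) := ⟨by omega⟩
  unfold Frame.point
  congr 2
  rw [Complex.exp_eq_exp_iff_exists_int]
  have hv : (((m : ZMod (2 * n)).val : ℕ) : ℤ) = m % ((2 * n : ℕ) : ℤ) := ZMod.val_intCast m
  have hdiv := Int.emod_add_mul_ediv m ((2 * n : ℕ) : ℤ)
  refine ⟨m / ((2 * n : ℕ) : ℤ), ?_⟩
  rw [← hv] at hdiv
  set q := m / ((2 * n : ℕ) : ℤ)
  set v := (m : ZMod (2 * n)).val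
  have hm : (m : ℂ) = v + 2 * n * q := by rw [← hdiv]; push_cast; ring
  have hn' : (n : ℂ) ≠ 0 := by exact_mod_cast hn.ne'
  push_cast
  rw [hm]
  field_simp
  ring

/-- The factor rotates the real axis to the direction halfway between places 0 and 1, so that places
`m` and `1 - m` become conjugate. -/
theorem Frame.point_intCast_eq (F : Frame) (hn : 0 < n) (m : ℤ) :
    F.point (m : ZMod (2 * n)) = F.center +
      (F.radius * Complex.exp (((F.angle - Real.pi / (2 * n) : ℝ) : ℂ) * Complex.I)) *
        ((Real.cos (Real.pi * (1 / 2 - m) / n) : ℝ) +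
          (Real.sin (Real.pi * (1 / 2 - m) / n) : ℝ) * Complex.I) := by
  rw [F.point_intCast hn, Complex.ofReal_cos, Complex.ofReal_sin, ← Complex.exp_mul_I, mul_assoc,
    ← Complex.exp_add]
  congr 3
  have hn' : (n : ℂ) ≠ 0 := by exact_mod_cast hn.ne'
  push_cast
  field_simp
  ring

theorem Frame.point_one_sub (F : Frame) (hn : 0 < n) (m : ℤ) :
    F.point ((1 - m : ℤ) : ZMod (2 * n)) = F.center +
      (F.radius * Complex.exp (((F.angle - Real.pi / (2 * n) : ℝ) : ℂ) * Complex.I)) *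
        ((Real.cos (Real.pi * (1 / 2 - m) / n) : ℝ) -
          (Real.sin (Real.pi * (1 / 2 - m) / n) : ℝ) * Complex.I) := by
  rw [F.point_intCast_eq hn]
  have e : Real.pi * (1 / 2 - ((1 - m : ℤ) : ℝ)) / n = -(Real.pi * (1 / 2 - m) / n) := by
    push_cast; ring
  rw [e, Real.cos_neg, Real.sin_neg]
  push_cast
  ring

theorem idxOf_two_pSeq (hn : 2 ≤ n) : (pSeq n).idxOf 2 = 0 := by
  obtain ⟨m, rfl⟩ : ∃ m, n = m + 2 := ⟨n - 2, by omega⟩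
  have : List.range' 1 (m + 2) = 1 :: 2 :: List.range' 3 m := by
    rw [List.range'_succ, List.range'_succ]
  unfold pSeq
  rw [this]
  simp

theorem reflection_lineM_point (hn : 2 ≤ n) (F : Frame) (A : Antichains (RootA n)) (m : ℤ) :
    EuclideanGeometry.reflection (lineM hn (phi F A)) (F.point (m : ZMod (2 * n))) =
      F.point ((1 - m : ℤ) : ZMod (2 * n)) := by
  have hn0 : 0 < n := by omega
  have h0 : phiPlace n 2 0 = ((0 : ℤ) : ZMod (2 * n)) := by
    simp [phiPlace, idxOf_two_pSeq hn]
  have h1 : phiPlace n 2 1 = ((1 - (0 : ℤ) : ℤ) : ZMod (2 * n)) := by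
    simp [phiPlace, idxOf_two_pSeq hn]
  have hline : lineM hn (phi F A) = AffineSubspace.perpBisector
      (F.point ((0 : ℤ) : ZMod (2 * n))) (F.point ((1 - (0 : ℤ) : ℤ) : ZMod (2 * n))) := by
    rw [← h0, ← h1]
    rfl
  rw [F.point_intCast_eq hn0, F.point_one_sub hn0] at hline
  have : ∀ a b : ℂ, Nonempty (AffineSubspace.perpBisector a b) := fun a b =>
    AffineSubspace.perpBisector_nonempty.to_subtype
  rw [EuclideanGeometry.eq_reflection_of_eq_subspace hline, F.point_intCast_eq hn0,
    F.point_one_sub hn0, reflection_perpBisector_apply]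
  -- The angle is `π / (2 * n)`; a nonzero sine says that places 0 and 1 are distinct, so that they
  -- determine the bisector.
  have hpos : 0 < Real.sin (Real.pi * (1 / 2 - ((0 : ℤ) : ℝ)) / n) := by
    have hn1 : (2 : ℝ) ≤ n := by exact_mod_cast hn
    apply Real.sin_pos_of_pos_of_lt_pi
    · have := Real.pi_pos
      push_cast
      rw [sub_zero]
      positivity
    · rw [div_lt_iff₀ (by positivity)]
      have := Real.pi_pos
      push_cast
      nlinarith
  exact hpos.ne'

theorem reflection_lineM_segment (hn : 2 ≤ n) (F : Frame) (A : Antichains (RootA n)) (p q : ℤ) :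
    EuclideanGeometry.reflection (lineM hn (phi F A)) ''
        segment ℝ (F.point (p : ZMod (2 * n))) (F.point (q : ZMod (2 * n))) =
      segment ℝ (F.point ((1 - p : ℤ) : ZMod (2 * n))) (F.point ((1 - q : ℤ) : ZMod (2 * n))) := by
  rw [← reflection_lineM_point hn F A p, ← reflection_lineM_point hn F A q]
  exact image_segment ℝ
    (EuclideanGeometry.reflection (lineM hn (phi F A))).toAffineEquiv.toAffineMap _ _

end Geometry

/-- The edges of the diagram of `A` in terms of a matching of `A`. -/
theorem IsMatching.mem_edges_phi {n : ℕ} {A : Antichains (RootA n)} {f : ℤ → ℤ}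
    (h : IsMatching n (IsMarked A) f) (F : Frame) (e : Set ℂ) :
    e ∈ (phi F A).edges ↔ ∃ p : ℤ, (-(n : ℤ) ≤ p ∧ p < n) ∧
      e = segment ℝ (F.point (p : ZMod (2 * n))) (F.point (f p : ZMod (2 * n))) := by
  constructor
  · rintro ⟨u, v, huv, rfl⟩
    obtain ⟨p, hp, rfl, rfl⟩ := (h.mem_edgesUpTo u v).mp huv
    exact ⟨p, hp, rfl⟩
  · rintro ⟨p, hp, rfl⟩
    exact ⟨_, _, (h.mem_edgesUpTo _ _).mpr ⟨p, hp, rfl, rfl⟩, rfl⟩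

/-- `σ` is `p ↦ -p` and `ρ` is `p ↦ p + 1`, both reduced to the range `-n, …, n - 1`, with `ρ'`
inverse to `ρ` there. Modulo `2 * n`, both `ρ ∘ σ` and `σ ∘ ρ'` are `p ↦ 1 - p`. -/
theorem edges_phi_row_Rvac {n : ℕ} (hn : 2 ≤ n) (F : Frame) (A : Antichains (RootA n)) :
    (phi F (row (Rvac A))).edges = ((phi F A).reflectEdges hn).edges := by
  obtain ⟨f, hf⟩ := exists_isMatching A
  obtain ⟨σ, hσ⟩ : ∃ σ : ℤ → ℤ, ∀ p, σ p = if p = -(n : ℤ) then -(n : ℤ) else -p :=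
    ⟨_, fun _ => rfl⟩
  obtain ⟨ρ, hρ⟩ : ∃ ρ : ℤ → ℤ, ∀ p, ρ p = if p = (n : ℤ) - 1 then -(n : ℤ) else p + 1 :=
    ⟨_, fun _ => rfl⟩
  obtain ⟨ρ', hρ'⟩ : ∃ ρ' : ℤ → ℤ, ∀ p, ρ' p = if p = -(n : ℤ) then (n : ℤ) - 1 else p - 1 :=
    ⟨_, fun _ => rfl⟩
  have hg := (hf.reflect_Rvac hσ).rotate_row (by omega) hρ hρ'
  have h2n : (2 * n : ZMod (2 * n)) = 0 := by exact_mod_cast ZMod.natCast_self (2 * n)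
  have hshift : ∀ p q : ℤ, q = 1 - p ∨ q = 1 - p - 2 * n →
      (q : ZMod (2 * n)) = ((1 - p : ℤ) : ZMod (2 * n)) := by
    rintro p q (rfl | rfl)
    · rfl
    · push_cast
      rw [h2n, sub_zero]
  have hcast : ∀ p : ℤ, ((ρ (σ p) : ℤ) : ZMod (2 * n)) = ((1 - p : ℤ) : ZMod (2 * n)) :=
    fun p => hshift _ _ (by rw [hρ, hσ]; split_ifs <;> omega)
  have hcast' : ∀ p : ℤ, ((σ (ρ' p) : ℤ) : ZMod (2 * n)) = ((1 - p : ℤ) : ZMod (2 * n)) :=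
    fun p => hshift _ _ (by rw [hσ, hρ']; split_ifs <;> omega)
  ext e
  rw [hg.mem_edges_phi]
  constructor
  · rintro ⟨p, hp, rfl⟩
    have hq : -(n : ℤ) ≤ σ (ρ' p) ∧ σ (ρ' p) < n := by
      rw [hσ, hρ']
      split_ifs <;> omega
    refine ⟨_, (hf.mem_edges_phi F _).mpr ⟨σ (ρ' p), hq, rfl⟩, ?_⟩
    simp only
    rw [reflection_lineM_segment, hcast]
    congr 2
    push_cast
    rw [hcast']
    push_cast
    ring
  · rintro ⟨_, he, rfl⟩
    obtain ⟨q, hq, rfl⟩ := (hf.mem_edges_phi F _).mp he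
    have hinv : σ (ρ' (ρ (σ q))) = q := by
      simp only [hσ, hρ', hρ]
      split_ifs <;> omega
    refine ⟨ρ (σ q), ?_, ?_⟩
    · rw [hρ, hσ]
      split_ifs <;> omega
    · simp only
      rw [reflection_lineM_segment, hinv, hcast, hcast]

end RowvacA

theorem mainTheorem6 {n : ℕ} (hn : 2 ≤ n) (F : RowvacA.Frame)
    (A : RowvacA.Antichains (RowvacA.RootA n)) :
    RowvacA.phi F (RowvacA.row (RowvacA.Rvac A)) =
      (RowvacA.phi F A).reflectEdges hn :=
  RowvacA.Diagram.ext rfl (RowvacA.edges_phi_row_Rvac hn F A)
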